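/- For every $\varepsilon>0$, almost all positive integers $n$ with $4\nmid n$ and $n\not\equiv 7 \pmod 8$ possess a representation $n=x_1^2+x_2^2+x_3^2$ with positive integers $x_1,x_2,x_3$ satisfying $$x_3\le (\log n)(\log\log n)^2(\log\log\log n)^{\varepsilon-2}.$$ Here "almost all" means that, for each fixed $\varepsilon>0$, the number of integers $n$ with $1\le n\le N$, $4\nmid n$ and $n\not\equiv 7\pmod 8$ that have no such representation is $o(N)$ as $N\to\infty$. (The finitely many $n$ for which $\log\log\log n$ is undefined or not positive play no role.) -/

import Mathlib

open Filter Topology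

/-- `AlmostAllNat P`: the property `P` holds for almost all positive integers `n`, i.e. the number
of `n` with `1 ≤ n ≤ N` for which `P n` fails is `o(N)` as `N → ∞`. -/
def AlmostAllNat (P : ℕ → Prop) : Prop :=
  Tendsto (fun N : ℕ => (Set.ncard {n : ℕ | 1 ≤ n ∧ n ≤ N ∧ ¬ P n} : ℝ) / (N : ℝ)) atTop (𝓝 0)

/-- `IsMicrosquareSum n Y`: the integer `n` is a sum of three squares of positive integers, the
third of which is the square of an integer at most `Y`. -/
def IsMicrosquareSum (n : ℕ) (Y : ℝ) : Prop :=
  ∃ x₁ x₂ x₃ : ℕ, 0 < x₁ ∧ 0 < x₂ ∧ 0 < x₃ ∧ n = x₁ ^ 2 + x₂ ^ 2 + x₃ ^ 2 ∧ (x₃ : ℝ) ≤ Y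

/-- A set of positive integers has density zero as soon as it is sparse in suitable intervals
between consecutive squares. -/
theorem tendsto_density_zero_of_windows (S : Set ℕ)
    (h : ∀ η : ℝ, 0 < η → ∀ᶠ E : ℕ in atTop, ∃ B : ℕ, B + 2 ≤ E ∧
      ((S ∩ Set.Ioc (B ^ 2) (E ^ 2)).ncard : ℝ) ≤ η * (B * ((E : ℝ) - B))) :
    Tendsto (fun N : ℕ => ((S ∩ Set.Icc 1 N).ncard : ℝ) / (N : ℝ)) atTop (𝓝 0) := by
  have fin : ∀ N, (S ∩ Set.Icc 1 N).Finite := fun N => (Set.finite_Icc 1 N).inter_of_right S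
  have key : ∀ η : ℝ, 0 < η → ∃ C : ℝ, ∀ N : ℕ, ((S ∩ Set.Icc 1 N).ncard : ℝ) ≤ C + η * N := by
    intro η hη
    obtain ⟨E0, hE0⟩ := eventually_atTop.1 (h η hη)
    refine ⟨(E0 ^ 2 : ℕ), fun N => ?_⟩
    induction N using Nat.strong_induction_on with
    | _ N ih =>
      by_cases hN : N < E0 ^ 2
      · have h1 : (S ∩ Set.Icc 1 N).ncard ≤ N := by
          calc (S ∩ Set.Icc 1 N).ncard ≤ (Set.Icc 1 N).ncard :=
                Set.ncard_le_ncard Set.inter_subset_right (Set.finite_Icc 1 N)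
            _ = N := by rw [Set.ncard_eq_toFinset_card']; simp
        have h2 : ((S ∩ Set.Icc 1 N).ncard : ℝ) ≤ (E0 ^ 2 : ℕ) := by
          exact_mod_cast h1.trans hN.le
        have : 0 ≤ η * N := by positivity
        linarith
      · push Not at hN
        have hs : E0 ≤ N.sqrt := by rw [Nat.le_sqrt']; exact hN
        obtain ⟨B, hB, hc⟩ := hE0 (N.sqrt + 1) (by omega)
        have hB' : B + 1 ≤ N.sqrt := by omega
        have hsq : N.sqrt ^ 2 ≤ N := Nat.sqrt_le' N
        have hsq2 : N < (N.sqrt + 1) ^ 2 := Nat.lt_succ_sqrt' N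
        have hBN : B ^ 2 < N := by nlinarith
        have hi := ih _ hBN
        have hsub : S ∩ Set.Icc 1 N ⊆ (S ∩ Set.Icc 1 (B ^ 2)) ∪
            (S ∩ Set.Ioc (B ^ 2) ((N.sqrt + 1) ^ 2)) := by
          rintro n ⟨hn, h1, h2⟩
          by_cases hnB : n ≤ B ^ 2
          · exact Or.inl ⟨hn, h1, hnB⟩
          · exact Or.inr ⟨hn, by push Not at hnB; exact hnB, by omega⟩
        have hcard : (S ∩ Set.Icc 1 N).ncard ≤ (S ∩ Set.Icc 1 (B ^ 2)).ncard +
            (S ∩ Set.Ioc (B ^ 2) ((N.sqrt + 1) ^ 2)).ncard :=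
          (Set.ncard_le_ncard hsub ((fin _).union
            ((Set.finite_Ioc _ _).inter_of_right S))).trans (Set.ncard_union_le _ _)
        have hcard' : ((S ∩ Set.Icc 1 N).ncard : ℝ) ≤ (S ∩ Set.Icc 1 (B ^ 2)).ncard +
            (S ∩ Set.Ioc (B ^ 2) ((N.sqrt + 1) ^ 2)).ncard := by exact_mod_cast hcard
        have hsqr : ((N.sqrt : ℕ) : ℝ) ^ 2 ≤ N := by exact_mod_cast hsq
        have hBr : (B : ℝ) + 1 ≤ N.sqrt := by exact_mod_cast hB'
        have hB0 : (0 : ℝ) ≤ B := by positivity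
        push_cast at hi hc
        have : (B : ℝ) ^ 2 + B * ((N.sqrt : ℝ) + 1 - B) ≤ N := by nlinarith
        push_cast
        nlinarith [mul_le_mul_of_nonneg_left this hη.le]
  rw [Metric.tendsto_atTop]
  intro ε hε
  obtain ⟨C, hC⟩ := key (ε / 2) (by positivity)
  obtain ⟨N0, hN0⟩ := exists_nat_gt (2 * |C| / ε)
  refine ⟨N0 + 1, fun N hN => ?_⟩
  have hNpos : (0 : ℝ) < N := by exact_mod_cast (by omega : 0 < N)
  rw [Real.dist_eq, sub_zero, abs_of_nonneg (by positivity), div_lt_iff₀ hNpos]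
  have h1 := hC N
  have h2 : (N0 : ℝ) + 1 ≤ N := by exact_mod_cast hN
  rw [div_lt_iff₀ hε] at hN0
  have h3 : C ≤ |C| := le_abs_self C
  nlinarith

/-- For squarefree `m` every integer is a sum of two squares modulo `m`. -/
theorem exists_sq_add_sq_modEq_of_squarefree {m : ℕ} (hm : Squarefree m) (t : ℤ) :
    ∃ b y : ℤ, (m : ℤ) ∣ b ^ 2 + y ^ 2 - t := by
  induction m using Nat.recOnPosPrimePosCoprime with
  | zero => exact absurd hm not_squarefree_zero
  | one => exact ⟨0, 0, by simp⟩
  | prime_pow p n hp hn =>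
    have : Fact p.Prime := ⟨hp⟩
    have hn1 : n = 1 := by
      by_contra hne
      have : 2 ≤ n := by omega
      have h2 : p * p ∣ p ^ n := by rw [← sq]; exact pow_dvd_pow p this
      exact hp.one_lt.ne' (Nat.isUnit_iff.1 (hm p h2))
    obtain ⟨a, b, hab⟩ := ZMod.sq_add_sq p (t : ZMod p)
    obtain ⟨a', rfl⟩ := ZMod.intCast_surjective a
    obtain ⟨b', rfl⟩ := ZMod.intCast_surjective b
    refine ⟨a', b', ?_⟩
    rw [hn1, pow_one, ← ZMod.intCast_zmod_eq_zero_iff_dvd]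
    push_cast
    rw [hab, sub_self]
  | coprime a b ha hb hab iha ihb =>
    obtain ⟨b1, y1, h1⟩ := iha (hm.squarefree_of_dvd (dvd_mul_right a b))
    obtain ⟨b2, y2, h2⟩ := ihb (hm.squarefree_of_dvd (dvd_mul_left b a))
    have hc : IsCoprime (a : ℤ) (b : ℤ) := Nat.isCoprime_iff_coprime.2 hab
    obtain ⟨u, v, huv⟩ := hc
    refine ⟨b1 * (v * b) + b2 * (u * a), y1 * (v * b) + y2 * (u * a), ?_⟩
    push_cast
    refine IsCoprime.mul_dvd (Nat.isCoprime_iff_coprime.2 hab) ?_ ?_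
    · have e : v * b = 1 - u * a := by linarith
      rw [e]
      obtain ⟨c, hc⟩ := h1
      refine ⟨c + (-2 * b1 * (b1 - b2) * u + u ^ 2 * a * (b1 - b2) ^ 2)
        + (-2 * y1 * (y1 - y2) * u + u ^ 2 * a * (y1 - y2) ^ 2), ?_⟩
      linear_combination hc
    · have e : u * a = 1 - v * b := by linarith
      rw [e]
      obtain ⟨c, hc⟩ := h2
      refine ⟨c + (-2 * b2 * (b2 - b1) * v + v ^ 2 * b * (b2 - b1) ^ 2)
        + (-2 * y2 * (y2 - y1) * v + v ^ 2 * b * (y2 - y1) ^ 2), ?_⟩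
      linear_combination hc

/-- An integer exceeding one that is coprime to the primorial of `W` exceeds `W`. -/
theorem lt_of_coprime_primorial {W d : ℕ} (hd : d ≠ 1) (h : Nat.Coprime d (primorial W)) :
    W < d ∨ d = 0 := by
  by_contra! hcon
  obtain ⟨h1, h0⟩ := hcon
  have hp := Nat.minFac_prime hd
  have hle : d.minFac ≤ W := (Nat.minFac_le (Nat.pos_of_ne_zero h0)).trans h1
  have := Nat.dvd_gcd (Nat.minFac_dvd d) (hp.dvd_primorial_iff.2 hle)
  rw [h] at this
  exact hp.one_lt.ne' (Nat.dvd_one.1 this)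

/-- Local solubility of `n = 1 + b ^ 2 + y ^ 2` to the modulus four times a primorial. -/
theorem exists_local_solution {W n : ℕ} (hW : 2 ≤ W) (h4 : ¬ 4 ∣ n) (h7 : ¬ n ≡ 7 [MOD 8]) :
    ∃ b y : ℤ, (4 * primorial W : ℤ) ∣ 1 + b ^ 2 + y ^ 2 - n := by
  obtain ⟨m, hm⟩ := Nat.prime_two.dvd_primorial_iff.2 hW
  have hsq := squarefree_primorial W
  rw [hm] at hsq ⊢
  have hodd : Nat.Coprime 2 m := Nat.coprime_of_squarefree_mul hsq
  have h8 : Nat.Coprime 8 m := by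
    have := Nat.Coprime.pow_left 3 hodd
    simpa using this
  obtain ⟨b1, y1, h1⟩ : ∃ b y : ℤ, (8 : ℤ) ∣ b ^ 2 + y ^ 2 - ((n : ℤ) - 1) := by
    unfold Nat.ModEq at h7
    have hcases : n % 8 = 1 ∨ n % 8 = 2 ∨ n % 8 = 3 ∨ n % 8 = 5 ∨ n % 8 = 6 := by omega
    rcases hcases with h | h | h | h | h
    · exact ⟨0, 0, by omega⟩
    · exact ⟨1, 0, by omega⟩
    · exact ⟨1, 1, by omega⟩
    · exact ⟨2, 0, by omega⟩
    · exact ⟨2, 1, by omega⟩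
  obtain ⟨b2, y2, h2⟩ := exists_sq_add_sq_modEq_of_squarefree
    (hsq.squarefree_of_dvd (dvd_mul_left m 2)) ((n : ℤ) - 1)
  obtain ⟨u, v, huv⟩ : IsCoprime (8 : ℤ) (m : ℤ) := by
    exact_mod_cast Nat.isCoprime_iff_coprime.2 h8
  have hcop : IsCoprime (8 : ℤ) (m : ℤ) := ⟨u, v, huv⟩
  refine ⟨b1 * (v * m) + b2 * (u * 8), y1 * (v * m) + y2 * (u * 8), ?_⟩
  have : (4 * ((2 * m : ℕ) : ℤ)) = 8 * m := by push_cast; ring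
  rw [this]
  refine hcop.mul_dvd ?_ ?_
  · have e : v * m = 1 - u * 8 := by linarith
    rw [e]
    obtain ⟨c, hc⟩ := h1
    refine ⟨c + (-2 * b1 * (b1 - b2) * u + u ^ 2 * 8 * (b1 - b2) ^ 2)
      + (-2 * y1 * (y1 - y2) * u + u ^ 2 * 8 * (y1 - y2) ^ 2), ?_⟩
    linear_combination hc
  · have e : u * 8 = 1 - v * m := by linarith
    rw [e]
    obtain ⟨c, hc⟩ := h2
    refine ⟨c + (-2 * b2 * (b2 - b1) * v + v ^ 2 * m * (b2 - b1) ^ 2)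
      + (-2 * y2 * (y2 - y1) * v + v ^ 2 * m * (y2 - y1) ^ 2), ?_⟩
    linear_combination hc

/-- Integers in an interval of length `L` that are congruent to each other modulo `m`. -/
theorem card_le_of_dvd_sub (X : Finset ℤ) (m : ℤ) (hm : 0 < m) (L : ℝ) (hL : 0 ≤ L)
    (h : ∀ x ∈ X, ∀ y ∈ X, m ∣ x - y ∧ ((x - y : ℤ) : ℝ) ≤ L) : (X.card : ℝ) ≤ L / m + 1 := by
  have hmr : (0 : ℝ) < m := by exact_mod_cast hm
  rcases X.eq_empty_or_nonempty with rfl | hX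
  · simp only [Finset.card_empty, Nat.cast_zero]; positivity
  · set x0 := X.min' hX with hx0
    have hx0m : x0 ∈ X := X.min'_mem hX
    have hcard : X.card ≤ (Finset.range (⌊L / m⌋₊ + 1)).card := by
      refine Finset.card_le_card_of_injOn (fun x => ((x - x0) / m).toNat) ?_ ?_
      · intro x hx
        have hx' : x ∈ X := hx
        obtain ⟨⟨c, hc⟩, hl⟩ := h x hx' x0 hx0m
        have hge : x0 ≤ x := X.min'_le x hx'
        have hdiv : (x - x0) / m = c := by rw [hc]; exact Int.mul_ediv_cancel_left c hm.ne'
        simp only [Finset.coe_range, Set.mem_Iio, hdiv]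
        rw [Nat.lt_add_one_iff, Nat.le_floor_iff (by positivity), le_div_iff₀ hmr]
        have hc0 : 0 ≤ c := by
          by_contra hneg
          push Not at hneg
          nlinarith
        have : ((c.toNat : ℕ) : ℝ) = (c : ℝ) := by exact_mod_cast Int.toNat_of_nonneg hc0
        rw [this]
        rw [hc] at hl
        push_cast at hl
        linarith
      · intro x hx y hy hxy
        have hx' : x ∈ X := hx
        have hy' : y ∈ X := hy
        obtain ⟨⟨c, hc⟩, -⟩ := h x hx' x0 hx0m
        obtain ⟨⟨c', hc'⟩, -⟩ := h y hy' x0 hx0m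
        have hgx : x0 ≤ x := X.min'_le x hx'
        have hgy : x0 ≤ y := X.min'_le y hy'
        have hdx : (x - x0) / m = c := by rw [hc]; exact Int.mul_ediv_cancel_left c hm.ne'
        have hdy : (y - x0) / m = c' := by rw [hc']; exact Int.mul_ediv_cancel_left c' hm.ne'
        simp only [hdx, hdy] at hxy
        have h1 : 0 ≤ c := by
          by_contra hneg
          push Not at hneg
          nlinarith
        have h2 : 0 ≤ c' := by
          by_contra hneg
          push Not at hneg
          nlinarith
        have : c = c' := by omega
        rw [this] at hc
        linarith
    rw [Finset.card_range] at hcard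
    have h1 : (X.card : ℝ) ≤ (⌊L / m⌋₊ : ℝ) + 1 := by exact_mod_cast hcard
    have h2 := Nat.floor_le (show 0 ≤ L / m by positivity)
    linarith

/-- Non-zero multiples of `m` in a symmetric interval. -/
theorem card_multiples_le (X : Finset ℤ) (m : ℤ) (hm : 0 < m) (L : ℝ) (hL : 0 ≤ L)
    (h : ∀ x ∈ X, x ≠ 0 ∧ m ∣ x ∧ (|x| : ℝ) ≤ L) : (X.card : ℝ) ≤ 2 * L / m := by
  have h0 : (0 : ℤ) ∉ X := fun h' => (h 0 h').1 rfl
  have := card_le_of_dvd_sub (insert 0 X) m hm (2 * L) (by positivity) ?_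
  · rw [Finset.card_insert_of_notMem h0] at this
    push_cast at this
    linarith
  · have h' : ∀ x ∈ insert 0 X, m ∣ x ∧ (|x| : ℝ) ≤ L := by
      intro x hx
      rcases Finset.mem_insert.1 hx with rfl | hx
      · simpa using hL
      · exact (h x hx).2
    intro x hx y hy
    refine ⟨dvd_sub (h' x hx).1 (h' y hy).1, ?_⟩
    have h1 := (h' x hx).2
    have h2 := (h' y hy).2
    push_cast
    linarith [le_abs_self (x : ℝ), neg_abs_le (y : ℝ)]

/-- The quadruples counted in the second moment, for a pair of small squares that gives rise to
the shift `k`. -/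
def shiftedQuadruples (Q β A J : ℕ) (k : ℤ) : Finset ((ℕ × ℕ) × (ℕ × ℕ)) :=
  ((Finset.range A ×ˢ Finset.range A) ×ˢ (Finset.range J ×ˢ Finset.range J)).filter
    (fun x => ((x.1.1 : ℤ) - x.1.2) * (1 + Q * (x.1.1 + x.1.2)) =
      ((x.2.2 : ℤ) - x.2.1) * (β + Q * (x.2.1 + x.2.2)) + k)

/-- The quadruples with prescribed sum of the first pair and difference of the second. -/
def quadrupleFiber (Q β A J : ℕ) (k : ℤ) (p : ℕ) (s : ℤ) : Finset ((ℕ × ℕ) × (ℕ × ℕ)) :=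
  (shiftedQuadruples Q β A J k).filter
    (fun x => x.1.1 + x.1.2 = p ∧ (x.2.2 : ℤ) - x.2.1 = s)

theorem mem_quadrupleFiber {Q β A J : ℕ} {k : ℤ} {p : ℕ} {s : ℤ} {i i' j j' : ℕ} :
    ((i, i'), (j, j')) ∈ quadrupleFiber Q β A J k p s ↔
      (i < A ∧ i' < A ∧ j < J ∧ j' < J) ∧ i + i' = p ∧ (j' : ℤ) - j = s ∧
      ((i : ℤ) - i') * (1 + Q * p) = s * (β + Q * (j + j')) + k := by
  simp only [quadrupleFiber, shiftedQuadruples, Finset.mem_filter, Finset.mem_product,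
    Finset.mem_range]
  constructor
  · rintro ⟨⟨⟨⟨h1, h2⟩, h3, h4⟩, h5⟩, h6, h7⟩
    refine ⟨⟨h1, h2, h3, h4⟩, h6, h7, ?_⟩
    rw [← h7, ← h6]; push_cast; exact h5
  · rintro ⟨⟨h1, h2, h3, h4⟩, h6, h7, h8⟩
    refine ⟨⟨⟨⟨h1, h2⟩, h3, h4⟩, ?_⟩, h6, h7⟩
    rw [← h7, ← h6] at h8; push_cast at h8; exact h8

theorem card_shiftedQuadruples (Q β A J : ℕ) (k : ℤ) :
    (shiftedQuadruples Q β A J k).card = ∑ p ∈ Finset.range (2 * A),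
      ∑ s ∈ Finset.Icc (-(J : ℤ)) J, (quadrupleFiber Q β A J k p s).card := by
  rw [← Finset.sum_product', Finset.card_eq_sum_card_fiberwise
    (f := fun x : (ℕ × ℕ) × (ℕ × ℕ) => (x.1.1 + x.1.2, (x.2.2 : ℤ) - x.2.1))
    (t := Finset.range (2 * A) ×ˢ Finset.Icc (-(J : ℤ)) J)]
  · refine Finset.sum_congr rfl fun y _ => ?_
    simp only [quadrupleFiber, Prod.ext_iff]
  · rintro ⟨⟨i, i'⟩, j, j'⟩ hx
    simp only [shiftedQuadruples, Finset.coe_filter, Finset.mem_product, Finset.mem_range] at hx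
    obtain ⟨⟨⟨h1, h2⟩, h3, h4⟩, -⟩ := hx
    simp only [Finset.coe_product, Set.mem_prod, Finset.coe_range, Set.mem_Iio, Finset.coe_Icc,
      Set.mem_Icc]
    dsimp only at h1 h2 h3 h4
    omega

/-- The conditions under which a fibre can be non-empty. -/
def FiberAdmissible (Q β A B : ℕ) (k : ℤ) (p : ℕ) (s : ℤ) : Prop :=
  ((Int.gcd (1 + Q * p) s : ℕ) : ℤ) ∣ k ∧ (2 : ℤ) ∣ p - s * β - k ∧
    |s| * B ≤ (min p (2 * A - p) : ℕ) * (1 + Q * p) + |k|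

theorem FiberAdmissible.of_mem {Q β A J B : ℕ} {k : ℤ} {p : ℕ} {s : ℤ} (hQ : Even Q)
    (hBβ : B ≤ β) {x} (hx : x ∈ quadrupleFiber Q β A J k p s) : FiberAdmissible Q β A B k p s := by
  obtain ⟨⟨i, i'⟩, j, j'⟩ := x
  obtain ⟨⟨h1, h2, h3, h4⟩, h5, h6, h7⟩ := mem_quadrupleFiber.1 hx
  refine ⟨?_, ?_, ?_⟩
  · have hk : k = ((i : ℤ) - i') * (1 + Q * p) - s * (β + Q * (j + j')) := by linarith
    rw [hk]
    exact dvd_sub (Dvd.dvd.mul_left (Int.gcd_dvd_left _ _) _)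
      (Dvd.dvd.mul_right (Int.gcd_dvd_right _ _) _)
  · obtain ⟨q, hq⟩ := hQ
    have hQ2 : (Q : ℤ) = q + q := by exact_mod_cast hq
    rw [hQ2] at h7
    have hp : (p : ℤ) = i + i' := by exact_mod_cast h5.symm
    refine ⟨i' - ((i : ℤ) - i') * q * p + s * q * (j + j'), ?_⟩
    linear_combination hp + h7
  · have hD : (B : ℤ) ≤ β + Q * (j + j') := by
      have : (B : ℤ) ≤ β := by exact_mod_cast hBβ
      have h' : (0 : ℤ) ≤ Q * (j + j') := by positivity
      linarith
    have hC : (0 : ℤ) ≤ 1 + Q * p := by positivity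
    have hu : |(i : ℤ) - i'| ≤ (min p (2 * A - p) : ℕ) := by
      rw [abs_le]; omega
    calc |s| * B ≤ |s| * (β + Q * (j + j')) := mul_le_mul_of_nonneg_left hD (abs_nonneg _)
      _ = |s * (β + Q * (j + j'))| := by rw [abs_mul, abs_of_nonneg (a := (β : ℤ) + _) (by positivity)]
      _ = |((i : ℤ) - i') * (1 + Q * p) - k| := by rw [h7]; ring_nf
      _ ≤ |((i : ℤ) - i') * (1 + Q * p)| + |k| := abs_sub _ _
      _ = |(i : ℤ) - i'| * (1 + Q * p) + |k| := by rw [abs_mul, abs_of_nonneg hC]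
      _ ≤ _ := by gcongr

theorem card_quadrupleFiber_le {Q β A J : ℕ} {k : ℤ} {p : ℕ} {s : ℤ} (hQ : Even Q) :
    ((quadrupleFiber Q β A J k p s).card : ℝ) ≤
      J * (Int.gcd (1 + Q * p) s : ℝ) / (1 + Q * p) + 1 := by
  set F := quadrupleFiber Q β A J k p s with hF
  set g := Int.gcd (1 + Q * p) s with hg
  have hCpos : (0 : ℤ) < 1 + Q * p := by positivity
  have hgpos : 0 < g := Int.gcd_pos_of_ne_zero_left _ hCpos.ne'
  obtain ⟨c, hc⟩ : (g : ℤ) ∣ 1 + Q * p := Int.gcd_dvd_left _ _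
  obtain ⟨t, ht⟩ : (g : ℤ) ∣ s := Int.gcd_dvd_right _ _
  have hgz : (0 : ℤ) < g := by exact_mod_cast hgpos
  have hcpos : 0 < c := by
    by_contra hneg
    push Not at hneg
    nlinarith
  have hct : IsCoprime c t := by
    rw [Int.isCoprime_iff_gcd_eq_one]
    have := Int.gcd_mul_left (g : ℤ) c t
    rw [← hc, ← ht, ← hg, Int.natAbs_natCast] at this
    exact Nat.eq_of_mul_eq_mul_left hgpos (by omega)
  have hcQ : IsCoprime c (Q : ℤ) := by
    refine ⟨g, -p, ?_⟩
    linear_combination -hc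
  have hcodd : IsCoprime c (2 : ℤ) := by
    obtain ⟨q, hq⟩ := hQ
    refine IsCoprime.of_isCoprime_of_dvd_right hcQ ⟨q, ?_⟩
    rw [hq]; push_cast; ring
  have himg : (F.image (fun x => ((x.2.1 : ℤ) + x.2.2))).card = F.card := by
    refine Finset.card_image_of_injOn ?_
    rintro ⟨⟨i, i'⟩, j, j'⟩ hx ⟨⟨l, l'⟩, r, r'⟩ hy hxy
    obtain ⟨-, h5, h6, h7⟩ := mem_quadrupleFiber.1 hx
    obtain ⟨-, h5', h6', h7'⟩ := mem_quadrupleFiber.1 hy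
    simp only at hxy
    rw [hxy] at h7
    have hu : ((i : ℤ) - i') = (l : ℤ) - l' := by
      have := h7.trans h7'.symm
      exact mul_right_cancel₀ hCpos.ne' this
    simp only [Prod.mk.injEq]
    omega
  rw [← himg]
  have := card_le_of_dvd_sub (F.image (fun x => ((x.2.1 : ℤ) + x.2.2))) (2 * c) (by omega)
    (2 * J) (by positivity) ?_
  · refine this.trans (le_of_eq ?_)
    have hcr : ((1 : ℝ) + Q * p) = g * c := by exact_mod_cast hc
    have h1 : (g : ℝ) ≠ 0 := by exact_mod_cast hgpos.ne'
    have h2 : (c : ℝ) ≠ 0 := by exact_mod_cast hcpos.ne'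
    rw [hcr]
    push_cast
    field_simp
  · intro x hx y hy
    obtain ⟨⟨⟨i, i'⟩, j, j'⟩, hxm, rfl⟩ := Finset.mem_image.1 hx
    obtain ⟨⟨⟨l, l'⟩, r, r'⟩, hym, rfl⟩ := Finset.mem_image.1 hy
    obtain ⟨⟨-, -, h3, h4⟩, h5, h6, h7⟩ := mem_quadrupleFiber.1 hxm
    obtain ⟨-, h5', h6', h7'⟩ := mem_quadrupleFiber.1 hym
    dsimp only
    constructor
    · refine IsCoprime.mul_dvd hcodd.symm ?_ ?_
      · omega
      · have hmul : (((i : ℤ) - i') - (l - l')) * c = t * Q * ((j + j') - (r + r')) := by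
          have hgne : (g : ℤ) ≠ 0 := hgz.ne'
          apply mul_left_cancel₀ hgne
          rw [hc] at h7 h7'
          linear_combination h7 - h7' + Q * ((j : ℤ) + j' - (r + r')) * ht
        have hd : c ∣ t * Q * (((j : ℤ) + j') - (r + r')) := ⟨((i : ℤ) - i') - (l - l'), by rw [← hmul]; ring⟩
        exact (hct.mul_right hcQ).dvd_of_dvd_mul_left hd
    · have : (((j : ℤ) + j') - (r + r')) ≤ 2 * J := by omega
      exact_mod_cast this

theorem sum_range_min_sub (A : ℕ) :
    ∑ p ∈ Finset.range (2 * A), min p (2 * A - p) = A ^ 2 := by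
  rw [two_mul, Finset.sum_range_add, ← Finset.sum_add_distrib]
  calc ∑ x ∈ Finset.range A, (min x (A + A - x) + min (A + x) (A + A - (A + x)))
      = ∑ x ∈ Finset.range A, A := by
        refine Finset.sum_congr rfl fun x hx => ?_
        rw [Finset.mem_range] at hx
        omega
    _ = A ^ 2 := by simp [sq]

theorem sum_filter_parity_le (f : ℕ → ℝ) (hf : ∀ p, |f (p + 1) - f p| ≤ 1) (r : ℤ) (n : ℕ) :
    ∑ p ∈ (Finset.range (2 * n)).filter (fun p : ℕ => (2 : ℤ) ∣ p - r), 2 * f p ≤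
      ∑ p ∈ Finset.range (2 * n), f p + n := by
  induction n with
  | zero => simp
  | succ n ih =>
    have e : 2 * (n + 1) = 2 * n + 1 + 1 := by ring
    have h1 := abs_le.1 (hf (2 * n))
    rw [Finset.sum_filter] at ih ⊢
    rw [e, Finset.sum_range_succ, Finset.sum_range_succ, Finset.sum_range_succ,
      Finset.sum_range_succ]
    by_cases hr : (2 : ℤ) ∣ ((2 * n : ℕ) : ℤ) - r
    · have hr' : ¬ (2 : ℤ) ∣ ((2 * n + 1 : ℕ) : ℤ) - r := by omega
      rw [if_pos hr, if_neg hr']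
      push_cast
      linarith
    · have hr' : (2 : ℤ) ∣ ((2 * n + 1 : ℕ) : ℤ) - r := by omega
      rw [if_neg hr, if_pos hr']
      push_cast
      linarith

/-- The bound for the difference of the larger variables when the sum of the smaller ones is
`p`. -/
noncomputable def fiberRange (Q A B : ℕ) (k : ℤ) (p : ℕ) : ℝ :=
  ((min p (2 * A - p) : ℕ) * (1 + Q * p) + |(k : ℝ)|) / B

theorem fiberRange_nonneg (Q A B : ℕ) (k : ℤ) (p : ℕ) : 0 ≤ fiberRange Q A B k p := by
  unfold fiberRange; positivity

theorem FiberAdmissible.abs_le {Q β A B : ℕ} {k : ℤ} {p : ℕ} {s : ℤ} (hB : 0 < B)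
    (h : FiberAdmissible Q β A B k p s) : |(s : ℝ)| ≤ fiberRange Q A B k p := by
  unfold fiberRange
  rw [le_div_iff₀ (by exact_mod_cast hB)]
  exact_mod_cast h.2.2

theorem fiberRange_div_le {Q A B : ℕ} {k : ℤ} {p : ℕ} :
    fiberRange Q A B k p / (1 + Q * p) ≤
      (min p (2 * A - p) : ℕ) / (B : ℝ) + |(k : ℝ)| / B := by
  unfold fiberRange
  have hC : (1 : ℝ) ≤ 1 + Q * p := by
    have : (0 : ℝ) ≤ Q * p := by positivity
    linarith
  rw [add_div, add_div]
  have h1 : ((min p (2 * A - p) : ℕ) * (1 + (Q : ℝ) * p)) / B / (1 + Q * p) =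
      (min p (2 * A - p) : ℕ) / (B : ℝ) := by
    field_simp
  rw [h1]
  have h2 : |(k : ℝ)| / B / (1 + Q * p) ≤ |(k : ℝ)| / B := div_le_self (by positivity) hC
  linarith

open Classical in
/-- Non-zero differences that are admissible. -/
noncomputable def admissibleDiffs (Q β A J B : ℕ) (k : ℤ) (p : ℕ) : Finset ℤ :=
  ((Finset.Icc (-(J : ℤ)) J).erase 0).filter (fun s => FiberAdmissible Q β A B k p s)

theorem sum_card_admissibleDiffs_le (Q β A J B : ℕ) (k : ℤ) (hB : 0 < B) :
    ∑ p ∈ Finset.range (2 * A), ((admissibleDiffs Q β A J B k p).card : ℝ) / (1 + Q * p) ≤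
      ((A : ℝ) ^ 2 + A + 4 * A * |(k : ℝ)|) / B +
        ∑ p ∈ Finset.range (2 * A), (1 : ℝ) / (1 + Q * p) := by
  have hBr : (0 : ℝ) < B := by exact_mod_cast hB
  have hmem : ∀ p s, s ∈ admissibleDiffs Q β A J B k p → s ≠ 0 ∧ FiberAdmissible Q β A B k p s := by
    intro p s hs
    classical
    unfold admissibleDiffs at hs
    rw [Finset.mem_filter, Finset.mem_erase] at hs
    exact ⟨hs.1.1, hs.2⟩
  have hm : ∑ p ∈ Finset.range (2 * A), (((min p (2 * A - p) : ℕ) : ℝ) / B) = (A : ℝ) ^ 2 / B := by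
    rw [← Finset.sum_div]
    congr 1
    exact_mod_cast sum_range_min_sub A
  rcases Int.even_or_odd β with hβ | hβ
  · obtain ⟨b, hb⟩ := hβ
    have h1 : ∀ p ∈ Finset.range (2 * A),
        ((admissibleDiffs Q β A J B k p).card : ℝ) / (1 + Q * p) ≤
        if (2 : ℤ) ∣ p - k then
          2 * (((min p (2 * A - p) : ℕ) : ℝ)) / B + 2 * |(k : ℝ)| / B else 0 := by
      intro p _
      split_ifs with hp
      · have h2 := card_multiples_le (admissibleDiffs Q β A J B k p) 1 one_pos
          (fiberRange Q A B k p) (fiberRange_nonneg _ _ _ _ _)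
          (fun s hs => ⟨(hmem p s hs).1, one_dvd _, by
            exact_mod_cast (hmem p s hs).2.abs_le hB⟩)
        have h3 := fiberRange_div_le (Q := Q) (A := A) (B := B) (k := k) (p := p)
        calc ((admissibleDiffs Q β A J B k p).card : ℝ) / (1 + Q * p)
            ≤ (2 * fiberRange Q A B k p / (1 : ℤ)) / (1 + Q * p) := by gcongr
          _ = 2 * (fiberRange Q A B k p / (1 + Q * p)) := by push_cast; ring
          _ ≤ 2 * ((min p (2 * A - p) : ℕ) / (B : ℝ) + |(k : ℝ)| / B) := by gcongr
          _ = _ := by ring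
      · have : admissibleDiffs Q β A J B k p = ∅ := by
          rw [Finset.eq_empty_iff_forall_notMem]
          intro s hs
          obtain ⟨c, hc⟩ := (hmem p s hs).2.2.1
          refine hp ⟨c + s * b, ?_⟩
          linear_combination hc + s * hb
        rw [this]; simp
    have h4 := sum_filter_parity_le (fun p => ((min p (2 * A - p) : ℕ) : ℝ))
      (fun p => by
        rw [_root_.abs_le]
        constructor
        · have : (min p (2 * A - p) : ℕ) ≤ (min (p + 1) (2 * A - (p + 1)) : ℕ) + 1 := by omega
          have : ((min p (2 * A - p) : ℕ) : ℝ) ≤ (min (p + 1) (2 * A - (p + 1)) : ℕ) + 1 := by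
            exact_mod_cast this
          linarith
        · have : (min (p + 1) (2 * A - (p + 1)) : ℕ) ≤ (min p (2 * A - p) : ℕ) + 1 := by omega
          have : ((min (p + 1) (2 * A - (p + 1)) : ℕ) : ℝ) ≤ (min p (2 * A - p) : ℕ) + 1 := by
            exact_mod_cast this
          linarith) k A
    have hs : ∑ p ∈ Finset.range (2 * A), (((min p (2 * A - p) : ℕ) : ℝ)) = (A : ℝ) ^ 2 := by
      exact_mod_cast sum_range_min_sub A
    rw [hs, Finset.sum_filter] at h4
    calc ∑ p ∈ Finset.range (2 * A), ((admissibleDiffs Q β A J B k p).card : ℝ) / (1 + Q * p)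
        ≤ ∑ p ∈ Finset.range (2 * A), ((if (2 : ℤ) ∣ p - k then
          2 * (((min p (2 * A - p) : ℕ) : ℝ)) else 0) / B + 2 * |(k : ℝ)| / B) := by
          refine Finset.sum_le_sum fun p hp => (h1 p hp).trans ?_
          have : 0 ≤ 2 * |(k : ℝ)| / B := by positivity
          split_ifs
          · rfl
          · simpa using this
      _ = (∑ p ∈ Finset.range (2 * A), (if (2 : ℤ) ∣ p - k then
          2 * (((min p (2 * A - p) : ℕ) : ℝ)) else 0)) / B + 2 * A * (2 * |(k : ℝ)| / B) := by
          rw [Finset.sum_add_distrib, ← Finset.sum_div]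
          simp
      _ ≤ ((A : ℝ) ^ 2 + A) / B + 2 * A * (2 * |(k : ℝ)| / B) := by gcongr
      _ = ((A : ℝ) ^ 2 + A + 4 * A * |(k : ℝ)|) / B := by ring
      _ ≤ _ := le_add_of_nonneg_right (Finset.sum_nonneg fun p _ => by positivity)
  · obtain ⟨b, hb⟩ := hβ
    have h1 : ∀ p ∈ Finset.range (2 * A),
        ((admissibleDiffs Q β A J B k p).card : ℝ) / (1 + Q * p) ≤
          ((min p (2 * A - p) : ℕ) : ℝ) / B + |(k : ℝ)| / B + 1 / (1 + Q * p) := by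
      intro p _
      have h2 := card_le_of_dvd_sub (admissibleDiffs Q β A J B k p) 2 two_pos
        (2 * fiberRange Q A B k p) (by have := fiberRange_nonneg Q A B k p; positivity) (by
          intro x hx y hy
          obtain ⟨-, hx⟩ := hmem p x hx
          obtain ⟨-, hy⟩ := hmem p y hy
          constructor
          · obtain ⟨c, hc⟩ := hx.2.1
            obtain ⟨d, hd⟩ := hy.2.1
            refine ⟨d - c - (x - y) * b, ?_⟩
            linear_combination hd - hc - (x - y) * hb
          · have h3 := hx.abs_le hB
            have h4 := hy.abs_le hB
            push_cast
            linarith [le_abs_self (x : ℝ), neg_abs_le (y : ℝ)])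
      have h3 := fiberRange_div_le (Q := Q) (A := A) (B := B) (k := k) (p := p)
      calc ((admissibleDiffs Q β A J B k p).card : ℝ) / (1 + Q * p)
          ≤ (2 * fiberRange Q A B k p / (2 : ℤ) + 1) / (1 + Q * p) := by gcongr
        _ = fiberRange Q A B k p / (1 + Q * p) + 1 / (1 + Q * p) := by push_cast; ring
        _ ≤ _ := by gcongr
    refine (Finset.sum_le_sum h1).trans ?_
    rw [Finset.sum_add_distrib, Finset.sum_add_distrib, hm]
    gcongr
    rw [Finset.sum_const, Finset.card_range, nsmul_eq_mul, ← mul_div_assoc, ← add_div]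
    gcongr
    · linarith [Nat.cast_nonneg (α := ℝ) A]
    · push_cast
      linarith [Nat.cast_nonneg (α := ℝ) A]

/-- The number of `p` below `2 * A` for which `1 + Q * p` is divisible by `d`. -/
theorem card_filter_dvd_one_add_mul_le (Q A d : ℕ) (hd : 0 < d) :
    (((Finset.range (2 * A)).filter (fun p => d ∣ 1 + Q * p)).card : ℝ) ≤ 2 * A / d + 1 := by
  set X := (Finset.range (2 * A)).filter (fun p => d ∣ 1 + Q * p) with hX
  have himg : (X.image (fun p : ℕ => (p : ℤ))).card = X.card :=
    Finset.card_image_of_injective _ Nat.cast_injective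
  rw [← himg]
  have := card_le_of_dvd_sub (X.image (fun p : ℕ => (p : ℤ))) d (by exact_mod_cast hd)
    (2 * A) (by positivity) ?_
  · rwa [Int.cast_natCast] at this
  · intro x hx y hy
    obtain ⟨p, hp, rfl⟩ := Finset.mem_image.1 hx
    obtain ⟨q, hq, rfl⟩ := Finset.mem_image.1 hy
    rw [hX, Finset.mem_filter, Finset.mem_range] at hp hq
    constructor
    · have h1 : (d : ℤ) ∣ 1 + Q * p := by exact_mod_cast hp.2
      have h2 : (d : ℤ) ∣ 1 + Q * q := by exact_mod_cast hq.2
      have hcop : IsCoprime (d : ℤ) (Q : ℤ) := by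
        obtain ⟨c, hc⟩ := h1
        exact ⟨c, -p, by linear_combination -hc⟩
      have h3 : (d : ℤ) ∣ Q * (p - q) := by
        have := dvd_sub h1 h2
        have e : (1 + (Q : ℤ) * p) - (1 + Q * q) = Q * (p - q) := by ring
        rwa [e] at this
      exact hcop.dvd_of_dvd_mul_left h3
    · have : (p : ℤ) - q ≤ 2 * A := by omega
      exact_mod_cast this

theorem card_quadrupleFiber_zero_le {Q β A J B : ℕ} {k : ℤ} {p : ℕ} (hQ : Even Q) (hBβ : B ≤ β) :
    ((quadrupleFiber Q β A J k p 0).card : ℝ) ≤ if ((1 + Q * p : ℕ) : ℤ) ∣ k then (J : ℝ) + 1 else 0 := by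
  rcases (quadrupleFiber Q β A J k p 0).eq_empty_or_nonempty with h | ⟨x, hx⟩
  · rw [h]; simp only [Finset.card_empty, Nat.cast_zero]; split_ifs <;> positivity
  · have hadm := FiberAdmissible.of_mem (B := B) hQ hBβ hx
    have h1 : ((Int.gcd (1 + Q * p) 0 : ℕ) : ℤ) = ((1 + Q * p : ℕ) : ℤ) := by
      rw [Int.gcd_zero_right]
      have : (1 + (Q : ℤ) * p) = ((1 + Q * p : ℕ) : ℤ) := by push_cast; ring
      rw [this, Int.natAbs_natCast]
    have h2 := hadm.1
    rw [h1] at h2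
    rw [if_pos h2]
    refine (card_quadrupleFiber_le hQ).trans (le_of_eq ?_)
    have h3 : ((Int.gcd (1 + Q * p) 0 : ℕ) : ℝ) = 1 + Q * p := by
      have : ((Int.gcd (1 + Q * p) 0 : ℕ)) = 1 + Q * p := by exact_mod_cast h1
      rw [this]; push_cast; ring
    rw [h3]
    have : (1 + (Q : ℝ) * p) ≠ 0 := by positivity
    field_simp

/-- Fibres with non-zero difference. -/
theorem sum_card_quadrupleFiber_le {Q β A J B : ℕ} {k : ℤ} {p : ℕ} (hQ : Even Q) (hB : 0 < B)
    (hBβ : B ≤ β) (D : Finset ℕ) (hD0 : ∀ d ∈ D, 0 < d)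
    (hD : ∀ s : ℤ, s ≠ 0 → ((Int.gcd (1 + Q * p) s : ℕ) : ℤ) ∣ k → Int.gcd (1 + Q * p) s ≠ 1 →
      Int.gcd (1 + Q * p) s ∈ D) :
    ∑ s ∈ (Finset.Icc (-(J : ℤ)) J).erase 0, ((quadrupleFiber Q β A J k p s).card : ℝ) ≤
      J * ((admissibleDiffs Q β A J B k p).card / (1 + Q * p)) + 2 * fiberRange Q A B k p +
      ∑ d ∈ D, if d ∣ 1 + Q * p then 2 * J * (fiberRange Q A B k p / (1 + Q * p)) else 0 := by
  classical
  have hCpos : (0 : ℝ) < 1 + Q * p := by positivity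
  set X := admissibleDiffs Q β A J B k p with hX
  have hmem : ∀ s, s ∈ X → s ≠ 0 ∧ FiberAdmissible Q β A B k p s := by
    intro s hs
    rw [hX] at hs
    unfold admissibleDiffs at hs
    rw [Finset.mem_filter, Finset.mem_erase] at hs
    exact ⟨hs.1.1, hs.2⟩
  have hzero : ∀ s ∈ (Finset.Icc (-(J : ℤ)) J).erase 0, s ∉ X →
      ((quadrupleFiber Q β A J k p s).card : ℝ) = 0 := by
    intro s hs hsX
    rw [Nat.cast_eq_zero, Finset.card_eq_zero, Finset.eq_empty_iff_forall_notMem]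
    intro x hx
    refine hsX ?_
    rw [hX]
    unfold admissibleDiffs
    convert Finset.mem_filter.2 ⟨hs, FiberAdmissible.of_mem (B := B) hQ hBβ hx⟩
  have hXsub : X ⊆ (Finset.Icc (-(J : ℤ)) J).erase 0 := by
    intro s hs
    rw [hX] at hs
    unfold admissibleDiffs at hs
    exact (Finset.mem_filter.1 hs).1
  rw [← Finset.sum_subset hXsub hzero]
  have hpt : ∀ s ∈ X, ((quadrupleFiber Q β A J k p s).card : ℝ) ≤
      J / (1 + Q * p) + 1 + ∑ d ∈ D, if d ∣ 1 + Q * p ∧ (d : ℤ) ∣ s then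
        J * (d : ℝ) / (1 + Q * p) else 0 := by
    intro s hs
    obtain ⟨hs0, hadm⟩ := hmem s hs
    refine (card_quadrupleFiber_le hQ).trans ?_
    have hnn : ∀ d ∈ D, (0 : ℝ) ≤ if d ∣ 1 + Q * p ∧ (d : ℤ) ∣ s then
        J * (d : ℝ) / (1 + Q * p) else 0 := by
      intro d _; split_ifs <;> positivity
    by_cases hg : Int.gcd (1 + Q * p) s = 1
    · rw [hg]
      have := Finset.sum_nonneg hnn
      push_cast
      rw [mul_one]
      linarith
    · have hgD := hD s hs0 hadm.1 hg
      have h1 := Finset.single_le_sum hnn hgD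
      have h2 : Int.gcd (1 + Q * p) s ∣ 1 + Q * p := by
        have : ((Int.gcd (1 + Q * p) s : ℕ) : ℤ) ∣ 1 + Q * p := Int.gcd_dvd_left _ _
        exact_mod_cast this
      rw [if_pos ⟨h2, Int.gcd_dvd_right _ _⟩] at h1
      have : (0 : ℝ) ≤ J / (1 + Q * p) := by positivity
      linarith
  refine (Finset.sum_le_sum hpt).trans ?_
  rw [Finset.sum_add_distrib, Finset.sum_add_distrib, Finset.sum_const, Finset.sum_const,
    Finset.sum_comm]
  have h1 : (X.card : ℝ) ≤ 2 * fiberRange Q A B k p := by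
    have := card_multiples_le X 1 one_pos (fiberRange Q A B k p) (fiberRange_nonneg _ _ _ _ _)
      (fun s hs => ⟨(hmem s hs).1, one_dvd _, by exact_mod_cast (hmem s hs).2.abs_le hB⟩)
    simpa using this
  refine add_le_add (add_le_add (le_of_eq ?_) ?_) (Finset.sum_le_sum fun d hd => ?_)
  · rw [nsmul_eq_mul]; ring
  · simpa using h1
  · by_cases hdC : d ∣ 1 + Q * p
    · rw [if_pos hdC]
      simp only [hdC, true_and]
      rw [← Finset.sum_filter, Finset.sum_const, nsmul_eq_mul]
      have hdr : (0 : ℝ) < d := by exact_mod_cast hD0 d hd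
      have h2 := card_multiples_le (X.filter (fun s => (d : ℤ) ∣ s)) d (by exact_mod_cast hD0 d hd)
        (fiberRange Q A B k p) (fiberRange_nonneg _ _ _ _ _) (fun s hs => by
          rw [Finset.mem_filter] at hs
          exact ⟨(hmem s hs.1).1, hs.2, by exact_mod_cast (hmem s hs.1).2.abs_le hB⟩)
      calc ((X.filter (fun s => (d : ℤ) ∣ s)).card : ℝ) * (J * (d : ℝ) / (1 + Q * p))
          ≤ (2 * fiberRange Q A B k p / (d : ℤ)) * (J * (d : ℝ) / (1 + Q * p)) := by gcongr
        _ = _ := by push_cast; field_simp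
    · rw [if_neg hdC]
      simp [hdC]

/-- The main upper bound for the number of quadruples. -/
theorem card_shiftedQuadruples_le {Q β A J B : ℕ} {k : ℤ} (hQ : Even Q) (hB : 0 < B)
    (hBβ : B ≤ β) (D : Finset ℕ) (hD0 : ∀ d ∈ D, 0 < d)
    (hD : ∀ p < 2 * A, ∀ s : ℤ, s ≠ 0 → ((Int.gcd (1 + Q * p) s : ℕ) : ℤ) ∣ k →
      Int.gcd (1 + Q * p) s ≠ 1 → Int.gcd (1 + Q * p) s ∈ D) :
    ((shiftedQuadruples Q β A J k).card : ℝ) ≤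
      J * (((A : ℝ) ^ 2 + A + 4 * A * |(k : ℝ)|) / B +
        ∑ p ∈ Finset.range (2 * A), (1 : ℝ) / (1 + Q * p)) +
      4 * A * ((A * (1 + Q * (2 * A)) + |(k : ℝ)|) / B) +
      2 * J * ((A + |(k : ℝ)|) / B) * ∑ d ∈ D, (2 * (A : ℝ) / d + 1) +
      (J + 1) * ((Finset.range (2 * A)).filter (fun p => ((1 + Q * p : ℕ) : ℤ) ∣ k)).card := by
  have hBr : (0 : ℝ) < B := by exact_mod_cast hB
  rw [card_shiftedQuadruples]
  push_cast
  have h0 : ∀ p, ∑ s ∈ Finset.Icc (-(J : ℤ)) J, ((quadrupleFiber Q β A J k p s).card : ℝ) =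
      ∑ s ∈ (Finset.Icc (-(J : ℤ)) J).erase 0, ((quadrupleFiber Q β A J k p s).card : ℝ) +
        ((quadrupleFiber Q β A J k p 0).card : ℝ) := by
    intro p
    rw [Finset.sum_erase_add]
    rw [Finset.mem_Icc]
    omega
  have h1 : ∀ p ∈ Finset.range (2 * A),
      ∑ s ∈ Finset.Icc (-(J : ℤ)) J, ((quadrupleFiber Q β A J k p s).card : ℝ) ≤
      J * ((admissibleDiffs Q β A J B k p).card / (1 + Q * p)) +
      2 * ((A * (1 + Q * (2 * A)) + |(k : ℝ)|) / B) +
      (∑ d ∈ D, if d ∣ 1 + Q * p then 2 * J * ((A + |(k : ℝ)|) / B) else 0) +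
      (if ((1 + Q * p : ℕ) : ℤ) ∣ k then (J : ℝ) + 1 else 0) := by
    intro p hp
    rw [Finset.mem_range] at hp
    have hmin : ((min p (2 * A - p) : ℕ) : ℝ) ≤ A := by
      have : (min p (2 * A - p) : ℕ) ≤ A := by omega
      exact_mod_cast this
    have hp' : (p : ℝ) ≤ 2 * A := by exact_mod_cast hp.le
    rw [h0]
    refine add_le_add ((sum_card_quadrupleFiber_le hQ hB hBβ D hD0 (hD p hp)).trans ?_)
      (card_quadrupleFiber_zero_le hQ hBβ)
    refine add_le_add (add_le_add le_rfl ?_) (Finset.sum_le_sum fun d _ => ?_)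
    · unfold fiberRange
      gcongr
    · have h3 : fiberRange Q A B k p / (1 + Q * p) ≤ (A + |(k : ℝ)|) / B := by
        refine fiberRange_div_le.trans ?_
        rw [add_div]
        gcongr
      split_ifs
      · exact mul_le_mul_of_nonneg_left h3 (by positivity)
      · exact le_rfl
  refine (Finset.sum_le_sum h1).trans ?_
  rw [Finset.sum_add_distrib, Finset.sum_add_distrib, Finset.sum_add_distrib]
  refine add_le_add (add_le_add (add_le_add ?_ (le_of_eq ?_)) ?_) (le_of_eq ?_)
  · rw [← Finset.mul_sum]
    gcongr
    exact sum_card_admissibleDiffs_le Q β A J B k hB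
  · rw [Finset.sum_const, Finset.card_range, nsmul_eq_mul]
    push_cast
    ring
  · rw [Finset.sum_comm, Finset.mul_sum]
    refine Finset.sum_le_sum fun d hd => ?_
    rw [← Finset.sum_filter, Finset.sum_const, nsmul_eq_mul, mul_comm]
    gcongr
    exact card_filter_dvd_one_add_mul_le Q A d (hD0 d hd)
  · rw [← Finset.sum_filter, Finset.sum_const, nsmul_eq_mul, mul_comm]
    push_cast
    rfl

theorem sum_Icc_inv_le (n : ℕ) : ∑ d ∈ Finset.Icc 1 n, (1 : ℝ) / d ≤ 1 + Real.log n := by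
  have h := harmonic_le_one_add_log n
  rw [harmonic_eq_sum_Icc] at h
  push_cast at h
  simpa [one_div] using h

theorem sum_range_inv_le (Q n : ℕ) (hQ : 1 ≤ Q) :
    ∑ p ∈ Finset.range n, (1 : ℝ) / (1 + Q * p) ≤ 1 + Real.log n := by
  refine le_trans ?_ (sum_Icc_inv_le n)
  rw [← Finset.Ico_add_one_right_eq_Icc, Finset.sum_Ico_eq_sum_range]
  refine Finset.sum_le_sum fun p _ => ?_
  have h : (1 : ℝ) ≤ Q := by exact_mod_cast hQ
  push_cast
  gcongr
  nlinarith [Nat.cast_nonneg (α := ℝ) p]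

/-- The divisors of `k` exceeding one that are coprime to `Q`. -/
def coprimeDivisors (Q : ℕ) (k : ℤ) : Finset ℕ :=
  k.natAbs.divisors.filter (fun d => d ≠ 1 ∧ Nat.Coprime d Q)

theorem coprime_of_gcd_one_add_mul {Q p : ℕ} {s : ℤ} :
    Nat.Coprime (Int.gcd (1 + Q * p) s) Q := by
  have h : (Int.gcd (1 + Q * p) s) ∣ 1 + Q * p := by
    have : ((Int.gcd (1 + Q * p) s : ℕ) : ℤ) ∣ 1 + Q * p := Int.gcd_dvd_left _ _
    exact_mod_cast this
  refine Nat.Coprime.coprime_dvd_left h ?_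
  simp

theorem card_shiftedQuadruples_le_of_ne_zero {Q β A J B K : ℕ} {k : ℤ} (hQ : Even Q) (hQ0 : 0 < Q)
    (hB : 0 < B) (hBβ : B ≤ β) (hA : 0 < A) (hJ : 0 < J) (hk : k ≠ 0) (hkK : |k| ≤ K)
    (hKA : K ≤ A) :
    ((shiftedQuadruples Q β A J k).card : ℝ) ≤
      (J * (A : ℝ) ^ 2 / B) * (1 + 1 / A + 4 * K / A + 16 * Q * A / J +
        12 * ∑ d ∈ coprimeDivisors Q k, (1 : ℝ) / d) +
      J * (1 + Real.log (2 * A)) + 2 * J * K := by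
  have hAr : (1 : ℝ) ≤ A := by exact_mod_cast hA
  have hJr : (1 : ℝ) ≤ J := by exact_mod_cast hJ
  have hQr : (1 : ℝ) ≤ Q := by exact_mod_cast hQ0
  have hBr : (0 : ℝ) < B := by exact_mod_cast hB
  have hkr : |(k : ℝ)| ≤ K := by exact_mod_cast hkK
  have hKAr : (K : ℝ) ≤ A := by exact_mod_cast hKA
  have hdiv : ∀ d ∈ coprimeDivisors Q k, 0 < d ∧ d ≤ K := by
    intro d hd
    have hd' := (Finset.mem_filter.1 hd).1
    refine ⟨Nat.pos_of_mem_divisors hd', (Nat.divisor_le hd').trans ?_⟩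
    have : (k.natAbs : ℤ) ≤ K := by rw [Int.natCast_natAbs]; exact hkK
    exact_mod_cast this
  have hmain := card_shiftedQuadruples_le (A := A) (J := J) (k := k) hQ hB hBβ
    (coprimeDivisors Q k) (fun d hd => (hdiv d hd).1) (by
      intro p _ s _ h1 h2
      refine Finset.mem_filter.2 ⟨Nat.mem_divisors.2 ⟨?_, Int.natAbs_ne_zero.2 hk⟩, h2,
        coprime_of_gcd_one_add_mul⟩
      exact Int.natCast_dvd.1 h1)
  refine hmain.trans ?_
  have hH := sum_range_inv_le Q (2 * A) hQ0
  have h2A : ((2 * A : ℕ) : ℝ) = 2 * A := by push_cast; ring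
  rw [h2A] at hH
  have e1 : J * (((A : ℝ) ^ 2 + A + 4 * A * |(k : ℝ)|) / B +
      ∑ p ∈ Finset.range (2 * A), (1 : ℝ) / (1 + Q * p)) ≤
      (J * (A : ℝ) ^ 2 / B) * (1 + 1 / A + 4 * K / A) + J * (1 + Real.log (2 * A)) := by
    calc _ ≤ J * (((A : ℝ) ^ 2 + A + 4 * A * K) / B + (1 + Real.log (2 * A))) := by gcongr
      _ = _ := by field_simp
  have e2 : 4 * A * ((A * (1 + Q * (2 * A)) + |(k : ℝ)|) / B) ≤
      (J * (A : ℝ) ^ 2 / B) * (16 * Q * A / J) := by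
    calc _ ≤ 4 * (A : ℝ) * ((A * (Q * A + Q * (2 * A)) + Q * A * A) / B) := by
          gcongr
          · nlinarith
          · calc |(k : ℝ)| ≤ 1 * 1 * A := by linarith
              _ ≤ Q * A * A := by gcongr
      _ = _ := by field_simp; ring
  have e3 : 2 * J * ((A + |(k : ℝ)|) / B) * ∑ d ∈ coprimeDivisors Q k, (2 * (A : ℝ) / d + 1) ≤
      (J * (A : ℝ) ^ 2 / B) * (12 * ∑ d ∈ coprimeDivisors Q k, (1 : ℝ) / d) := by
    have h1 : ∑ d ∈ coprimeDivisors Q k, (2 * (A : ℝ) / d + 1) ≤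
        3 * A * ∑ d ∈ coprimeDivisors Q k, (1 : ℝ) / d := by
      rw [Finset.mul_sum]
      refine Finset.sum_le_sum fun d hd => ?_
      obtain ⟨h0, h1⟩ := hdiv d hd
      have hd0 : (0 : ℝ) < d := by exact_mod_cast h0
      have hd1 : (d : ℝ) ≤ A := by exact_mod_cast h1.trans hKA
      have : 1 ≤ (A : ℝ) / d := by rwa [le_div_iff₀ hd0, one_mul]
      calc 2 * (A : ℝ) / d + 1 ≤ 2 * (A : ℝ) / d + A / d := by gcongr
        _ = _ := by ring
    calc _ ≤ 2 * J * ((A + A) / B) * (3 * A * ∑ d ∈ coprimeDivisors Q k, (1 : ℝ) / d) := by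
          gcongr
          linarith
      _ = _ := by ring
  have e4 : ((J : ℝ) + 1) *
      ((Finset.range (2 * A)).filter (fun p => ((1 + Q * p : ℕ) : ℤ) ∣ k)).card ≤ 2 * J * K := by
    have h1 : ((Finset.range (2 * A)).filter (fun p => ((1 + Q * p : ℕ) : ℤ) ∣ k)).card ≤ K := by
      rw [← Finset.card_range K]
      refine Finset.card_le_card fun p hp => ?_
      have h2 := (Finset.mem_filter.1 hp).2
      rw [Finset.mem_range]
      have h3 := Int.le_of_dvd (abs_pos.2 hk) ((dvd_abs _ _).2 h2)
      have h4 : (1 + Q * p : ℕ) ≤ K := by exact_mod_cast h3.trans hkK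
      nlinarith
    have h2 : (((Finset.range (2 * A)).filter (fun p => ((1 + Q * p : ℕ) : ℤ) ∣ k)).card : ℝ) ≤ K := by
      exact_mod_cast h1
    calc _ ≤ ((J : ℝ) + J) * K := by gcongr
      _ = _ := by ring
  linarith

theorem card_shiftedQuadruples_zero_le {Q β A J B : ℕ} (hQ : Even Q) (hQ0 : 0 < Q)
    (hB : 0 < B) (hBβ : B ≤ β) (hA : 0 < A) (hJ : 0 < J) :
    ((shiftedQuadruples Q β A J 0).card : ℝ) ≤
      (J * (A : ℝ) ^ 2 / B) * (2 + 4 * (1 + Real.log (1 + 2 * Q * A)) + 4 * Q + 16 * Q * A / J) +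
      J * (1 + Real.log (2 * A)) + 4 * J * A := by
  have hAr : (1 : ℝ) ≤ A := by exact_mod_cast hA
  have hJr : (1 : ℝ) ≤ J := by exact_mod_cast hJ
  have hQr : (1 : ℝ) ≤ Q := by exact_mod_cast hQ0
  have hBr : (0 : ℝ) < B := by exact_mod_cast hB
  have hmain := card_shiftedQuadruples_le (A := A) (J := J) (k := 0) hQ hB hBβ
    (Finset.Ioc 1 (1 + 2 * Q * A)) (fun d hd => by rw [Finset.mem_Ioc] at hd; omega) (by
      intro p hp s _ h1 h2
      have h3 : (Int.gcd (1 + Q * p) s) ∣ 1 + Q * p := by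
        have : ((Int.gcd (1 + Q * p) s : ℕ) : ℤ) ∣ 1 + Q * p := Int.gcd_dvd_left _ _
        exact_mod_cast this
      have h4 := Nat.pos_of_dvd_of_pos h3 (by positivity)
      have h5 := Nat.le_of_dvd (by positivity) h3
      have h6 : Q * p ≤ Q * (2 * A) := by gcongr
      rw [Finset.mem_Ioc]
      refine ⟨by omega, h5.trans ?_⟩
      linarith)
  refine hmain.trans ?_
  have hH := sum_range_inv_le Q (2 * A) hQ0
  have h2A : ((2 * A : ℕ) : ℝ) = 2 * A := by push_cast; ring
  rw [h2A] at hH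
  have e1 : J * (((A : ℝ) ^ 2 + A + 4 * A * |((0 : ℤ) : ℝ)|) / B +
      ∑ p ∈ Finset.range (2 * A), (1 : ℝ) / (1 + Q * p)) ≤
      (J * (A : ℝ) ^ 2 / B) * 2 + J * (1 + Real.log (2 * A)) := by
    simp only [Int.cast_zero, abs_zero, mul_zero, add_zero]
    calc _ ≤ J * (((A : ℝ) ^ 2 + A ^ 2) / B + (1 + Real.log (2 * A))) := by
          gcongr
          nlinarith
      _ = _ := by ring
  have e2 : 4 * A * ((A * (1 + Q * (2 * A)) + |((0 : ℤ) : ℝ)|) / B) ≤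
      (J * (A : ℝ) ^ 2 / B) * (16 * Q * A / J) := by
    simp only [Int.cast_zero, abs_zero, add_zero]
    calc _ ≤ 4 * (A : ℝ) * ((A * (2 * (Q * A) + Q * (2 * A))) / B) := by
          gcongr
          nlinarith
      _ = _ := by field_simp; ring
  have e3 : 2 * J * ((A + |((0 : ℤ) : ℝ)|) / B) *
      ∑ d ∈ Finset.Ioc 1 (1 + 2 * Q * A), (2 * (A : ℝ) / d + 1) ≤
      (J * (A : ℝ) ^ 2 / B) * (4 * (1 + Real.log (1 + 2 * Q * A)) + 4 * Q) := by
    have h0 := sum_Icc_inv_le (1 + 2 * Q * A)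
    push_cast at h0
    have h1 : ∑ d ∈ Finset.Ioc 1 (1 + 2 * Q * A), (2 * (A : ℝ) / d + 1) ≤
        2 * A * (1 + Real.log (1 + 2 * Q * A)) + 2 * Q * A := by
      rw [Finset.sum_add_distrib]
      refine add_le_add ?_ (le_of_eq ?_)
      · calc ∑ d ∈ Finset.Ioc 1 (1 + 2 * Q * A), 2 * (A : ℝ) / d
            = 2 * A * ∑ d ∈ Finset.Ioc 1 (1 + 2 * Q * A), (1 : ℝ) / d := by
              rw [Finset.mul_sum]
              exact Finset.sum_congr rfl fun d _ => by ring
          _ ≤ 2 * A * ∑ d ∈ Finset.Icc 1 (1 + 2 * Q * A), (1 : ℝ) / d := by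
              gcongr
              exact Finset.Ioc_subset_Icc_self
          _ ≤ _ := by gcongr
      · simp
    simp only [Int.cast_zero, abs_zero, add_zero]
    calc _ ≤ 2 * J * (A / B) * (2 * A * (1 + Real.log (1 + 2 * Q * A)) + 2 * Q * A) := by gcongr
      _ = _ := by ring
  have e4 : ((J : ℝ) + 1) *
      ((Finset.range (2 * A)).filter (fun p => ((1 + Q * p : ℕ) : ℤ) ∣ 0)).card ≤ 4 * J * A := by
    simp only [dvd_zero, Finset.filter_true, Finset.card_range]
    push_cast
    nlinarith
  linarith

/-- The tail of the double series of `(x * y) ^ (-3/2)` is small. -/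
theorem exists_tail_bound (ε : ℝ) (hε : 0 < ε) : ∃ W0 : ℕ, ∀ t : Finset (ℕ × ℕ),
    (∀ x ∈ t, W0 < x.1 * x.2) →
      ∑ x ∈ t, (((x.1 : ℝ) ^ (3 / 2 : ℝ))⁻¹ * ((x.2 : ℝ) ^ (3 / 2 : ℝ))⁻¹) ≤ ε := by
  have h1 : Summable (fun n : ℕ => ((n : ℝ) ^ (3 / 2 : ℝ))⁻¹) :=
    Real.summable_nat_rpow_inv.2 (by norm_num)
  have h2 : Summable (fun x : ℕ × ℕ =>
      (((x.1 : ℝ) ^ (3 / 2 : ℝ))⁻¹ * ((x.2 : ℝ) ^ (3 / 2 : ℝ))⁻¹)) :=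
    h1.mul_of_nonneg h1 (fun n => by positivity) (fun n => by positivity)
  obtain ⟨s, hs⟩ := summable_iff_vanishing_norm.1 h2 ε hε
  refine ⟨s.sup (fun x => x.1 * x.2), fun t ht => ?_⟩
  have := hs t (Finset.disjoint_left.2 fun x hxt hxs => by
    have h3 := ht x hxt
    have h4 := Finset.le_sup (f := fun x : ℕ × ℕ => x.1 * x.2) hxs
    omega)
  exact (le_abs_self _).trans this.le

theorem inv_max_le (x y : ℕ) (hx : 0 < x) (hy : 0 < y) (Z : ℝ) (hZ : 0 ≤ Z) (N : ℝ)
    (h1 : N ≤ 2 * Z ^ 2 / x) (h2 : N ≤ Z ^ 2 / y + Z) :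
    1 / ((x : ℝ) * y) * N ≤ 2 * Z ^ 2 * (((x : ℝ) ^ (3 / 2 : ℝ))⁻¹ * ((y : ℝ) ^ (3 / 2 : ℝ))⁻¹) +
      Z * (1 / x * (1 / y)) := by
  have hxr : (0 : ℝ) < x := by exact_mod_cast hx
  have hyr : (0 : ℝ) < y := by exact_mod_cast hy
  have e : ∀ t : ℝ, 0 < t → t ^ (3 / 2 : ℝ) = t * √t := by
    intro t ht
    rw [show (3 / 2 : ℝ) = 1 + 1 / 2 by norm_num, Real.rpow_add ht, Real.rpow_one,
      Real.sqrt_eq_rpow]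
  rw [e _ hxr, e _ hyr]
  have hsx : 0 < √(x : ℝ) := Real.sqrt_pos.2 hxr
  have hsy : 0 < √(y : ℝ) := Real.sqrt_pos.2 hyr
  have hN : N ≤ 2 * Z ^ 2 / (√x * √y) + Z := by
    rcases le_total x y with h | h
    · have hs : √(x : ℝ) ≤ √y := Real.sqrt_le_sqrt (by exact_mod_cast h)
      have h3 : √(x : ℝ) * √y ≤ y := by
        calc √(x : ℝ) * √y ≤ √y * √y := by gcongr
          _ = y := Real.mul_self_sqrt hyr.le
      have h4 : Z ^ 2 / y ≤ 2 * Z ^ 2 / (√x * √y) := by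
        gcongr
        nlinarith [sq_nonneg Z]
      linarith
    · have hs : √(y : ℝ) ≤ √x := Real.sqrt_le_sqrt (by exact_mod_cast h)
      have h3 : √(x : ℝ) * √y ≤ x := by
        calc √(x : ℝ) * √y ≤ √x * √x := by gcongr
          _ = x := Real.mul_self_sqrt hxr.le
      have h4 : 2 * Z ^ 2 / x ≤ 2 * Z ^ 2 / (√x * √y) := by gcongr
      linarith
  calc 1 / ((x : ℝ) * y) * N ≤ 1 / ((x : ℝ) * y) * (2 * Z ^ 2 / (√x * √y) + Z) := by gcongr
    _ = _ := by field_simp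

/-- The shift associated with the pair of small squares with parameters `z` and `z'`. -/
def pairShift (Q y₀ z z' : ℕ) : ℤ := ((z' : ℤ) - z) * (y₀ + Q * (z + z'))

theorem pairShift_ne_zero {Q y₀ z z' : ℕ} (hy : 0 < y₀) (h : z ≠ z') : pairShift Q y₀ z z' ≠ 0 := by
  unfold pairShift
  refine mul_ne_zero (by omega) ?_
  have : (0 : ℤ) < y₀ + Q * (z + z') := by positivity
  exact this.ne'

theorem sum_coprimeDivisors_le {Q y₀ z z' W X Z : ℕ} (hy : 0 < y₀) (hzz : z ≠ z') (hz : z < Z)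
    (hz' : z' < Z) (hX : y₀ + 2 * Q * Z ≤ X) (hZX : Z ≤ X)
    (hW : ∀ d : ℕ, d ≠ 0 → d ≠ 1 → Nat.Coprime d Q → W < d) :
    ∑ d ∈ coprimeDivisors Q (pairShift Q y₀ z z'), (1 : ℝ) / d ≤
      ∑ x ∈ (Finset.Icc 1 X ×ˢ Finset.Icc 1 X).filter
        (fun x => W < x.1 * x.2 ∧ Nat.Coprime x.2 Q),
        if (x.1 : ℤ) ∣ (z' : ℤ) - z ∧ (x.2 : ℤ) ∣ y₀ + Q * (z + z') then
          1 / ((x.1 : ℝ) * x.2) else 0 := by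
  rw [← Finset.sum_filter]
  set w := ((z' : ℤ) - z).natAbs with hw
  have hw0 : 0 < w := by omega
  have hwZ : w ≤ Z := by omega
  set D := coprimeDivisors Q (pairShift Q y₀ z z') with hD
  have hk := pairShift_ne_zero (Q := Q) hy hzz
  have hmul : ∀ d ∈ D, Nat.gcd d w * (d / Nat.gcd d w) = d := fun d _ =>
    Nat.mul_div_cancel' (Nat.gcd_dvd_left d w)
  have hinj : Set.InjOn (fun d : ℕ => (Nat.gcd d w, d / Nat.gcd d w)) D := by
    intro d hd d' hd' h
    simp only [Prod.mk.injEq] at h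
    rw [← hmul d hd, ← hmul d' hd', h.2, h.1]
  have hsum : ∑ d ∈ D, (1 : ℝ) / d =
      ∑ x ∈ D.image (fun d : ℕ => (Nat.gcd d w, d / Nat.gcd d w)), 1 / ((x.1 : ℝ) * x.2) := by
    rw [Finset.sum_image hinj]
    refine Finset.sum_congr rfl fun d hd => ?_
    congr 1
    exact_mod_cast (hmul d hd).symm
  rw [hsum]
  refine Finset.sum_le_sum_of_subset_of_nonneg ?_ (fun x _ _ => by positivity)
  intro x hx
  obtain ⟨d, hd, rfl⟩ := Finset.mem_image.1 hx
  have hd' := Finset.mem_filter.1 (hD ▸ hd)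
  have hdpos := Nat.pos_of_mem_divisors hd'.1
  have hgpos : 0 < Nat.gcd d w := Nat.gcd_pos_of_pos_left _ hdpos
  have h2pos : 0 < d / Nat.gcd d w := Nat.div_pos (Nat.gcd_le_left _ hdpos) hgpos
  have hdvd : d / Nat.gcd d w ∣ y₀ + Q * (z + z') := by
    have h1 : d ∣ w * (y₀ + Q * (z + z')) := by
      have h2 := Nat.dvd_of_mem_divisors hd'.1
      unfold pairShift at h2
      rw [Int.natAbs_mul, ← hw] at h2
      have h3 : ((y₀ : ℤ) + Q * (z + z')).natAbs = y₀ + Q * (z + z') := by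
        rw [show (y₀ : ℤ) + Q * (z + z') = ((y₀ + Q * (z + z') : ℕ) : ℤ) by push_cast; ring,
          Int.natAbs_natCast]
      rwa [h3] at h2
    have h2 : d / Nat.gcd d w ∣ (w / Nat.gcd d w) * (y₀ + Q * (z + z')) := by
      have h3 : Nat.gcd d w ∣ w := Nat.gcd_dvd_right d w
      rw [Nat.div_mul_right_comm h3]
      exact Nat.div_dvd_div (Nat.gcd_dvd_left d w) h1
    exact (Nat.coprime_div_gcd_div_gcd hgpos).dvd_of_dvd_mul_left h2
  have hle2 : d / Nat.gcd d w ≤ X := by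
    refine (Nat.le_of_dvd (by positivity) hdvd).trans (le_trans ?_ hX)
    have : Q * (z + z') ≤ Q * (2 * Z) := Nat.mul_le_mul_left _ (by omega)
    linarith
  have hle1 : Nat.gcd d w ≤ X := (Nat.gcd_le_right _ hw0).trans (hwZ.trans hZX)
  refine Finset.mem_filter.2 ⟨Finset.mem_filter.2 ⟨Finset.mem_product.2
    ⟨Finset.mem_Icc.2 ⟨hgpos, hle1⟩, Finset.mem_Icc.2 ⟨h2pos, hle2⟩⟩, ?_, ?_⟩, ?_, ?_⟩
  · simp only
    rw [hmul d hd]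
    exact hW d hdpos.ne' hd'.2.1 hd'.2.2
  · exact Nat.Coprime.coprime_dvd_left (Nat.div_dvd_of_dvd (Nat.gcd_dvd_left d w)) hd'.2.2
  · simp only
    exact Int.natCast_dvd.2 (Nat.gcd_dvd_right d w)
  · simp only
    exact_mod_cast hdvd

/-- On average over pairs of small squares the sum over divisors of the shift is small. -/
theorem sum_pairs_coprimeDivisors_le {Q y₀ W X Z : ℕ} {ε : ℝ} (hy : 0 < y₀)
    (hX : y₀ + 2 * Q * Z ≤ X) (hZX : Z ≤ X)
    (hW : ∀ d : ℕ, d ≠ 0 → d ≠ 1 → Nat.Coprime d Q → W < d)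
    (htail : ∀ t : Finset (ℕ × ℕ), (∀ x ∈ t, W < x.1 * x.2) →
      ∑ x ∈ t, (((x.1 : ℝ) ^ (3 / 2 : ℝ))⁻¹ * ((x.2 : ℝ) ^ (3 / 2 : ℝ))⁻¹) ≤ ε) :
    ∑ x ∈ (Finset.range Z).offDiag,
      ∑ d ∈ coprimeDivisors Q (pairShift Q y₀ x.1 x.2), (1 : ℝ) / d ≤
      2 * Z ^ 2 * ε + Z * (1 + Real.log X) ^ 2 := by
  set P := (Finset.Icc 1 X ×ˢ Finset.Icc 1 X).filter
    (fun x => W < x.1 * x.2 ∧ Nat.Coprime x.2 Q) with hP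
  calc ∑ x ∈ (Finset.range Z).offDiag,
      ∑ d ∈ coprimeDivisors Q (pairShift Q y₀ x.1 x.2), (1 : ℝ) / d
      ≤ ∑ z ∈ (Finset.range Z).offDiag, ∑ x ∈ P,
        if (x.1 : ℤ) ∣ (z.2 : ℤ) - z.1 ∧ (x.2 : ℤ) ∣ y₀ + Q * (z.1 + z.2) then
          1 / ((x.1 : ℝ) * x.2) else 0 := by
        refine Finset.sum_le_sum fun z hz => ?_
        rw [Finset.mem_offDiag, Finset.mem_range, Finset.mem_range] at hz
        exact sum_coprimeDivisors_le hy hz.2.2 hz.1 hz.2.1 hX hZX hW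
    _ ≤ ∑ x ∈ P, (2 * (Z : ℝ) ^ 2 * (((x.1 : ℝ) ^ (3 / 2 : ℝ))⁻¹ * ((x.2 : ℝ) ^ (3 / 2 : ℝ))⁻¹) +
        Z * (1 / (x.1 : ℝ) * (1 / x.2))) := by
        rw [Finset.sum_comm]
        refine Finset.sum_le_sum fun x hx => ?_
        rw [hP, Finset.mem_filter, Finset.mem_product, Finset.mem_Icc, Finset.mem_Icc] at hx
        obtain ⟨⟨⟨hx1, -⟩, hx2, -⟩, -, hcop⟩ := hx
        rw [← Finset.sum_filter, Finset.sum_const, nsmul_eq_mul, mul_comm]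
        set T := (Finset.range Z).offDiag.filter (fun z : ℕ × ℕ =>
          (x.1 : ℤ) ∣ (z.2 : ℤ) - z.1 ∧ (x.2 : ℤ) ∣ y₀ + Q * (z.1 + z.2)) with hT
        have hmem : ∀ z, z ∈ T → z.1 < Z ∧ z.2 < Z ∧ z.1 ≠ z.2 ∧ (x.1 : ℤ) ∣ (z.2 : ℤ) - z.1 ∧
            (x.2 : ℤ) ∣ y₀ + Q * (z.1 + z.2) := by
          intro z hz
          rw [hT, Finset.mem_filter, Finset.mem_offDiag, Finset.mem_range, Finset.mem_range] at hz
          exact ⟨hz.1.1, hz.1.2.1, hz.1.2.2, hz.2.1, hz.2.2⟩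
        have hfib : ∀ b : ℝ, (∀ z ∈ Finset.range Z, ((T.filter (fun y => y.1 = z)).card : ℝ) ≤ b) →
            (T.card : ℝ) ≤ Z * b := by
          intro b hb
          rw [Finset.card_eq_sum_card_fiberwise (f := Prod.fst) (t := Finset.range Z)
            (fun z hz => by simpa using (hmem z hz).1)]
          push_cast
          calc _ ≤ ∑ z ∈ Finset.range Z, b := Finset.sum_le_sum hb
            _ = Z * b := by simp
        have himg : ∀ z, ((T.filter (fun y => y.1 = z)).image
            (fun y : ℕ × ℕ => (y.2 : ℤ) - y.1)).card = (T.filter (fun y => y.1 = z)).card := by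
          intro z
          refine Finset.card_image_of_injOn ?_
          rintro ⟨a, b⟩ hy ⟨c, d⟩ hy' h
          have h1 := (Finset.mem_filter.1 hy).2
          have h2 := (Finset.mem_filter.1 hy').2
          simp only at h h1 h2
          simp only [Prod.mk.injEq]
          omega
        refine inv_max_le x.1 x.2 hx1 hx2 Z (by positivity) _ ?_ ?_
        · have := hfib (2 * Z / x.1) (fun z hz => by
            rw [← himg z]
            have := card_multiples_le ((T.filter (fun y => y.1 = z)).image
              (fun y : ℕ × ℕ => (y.2 : ℤ) - y.1)) x.1 (by exact_mod_cast hx1) Z (by positivity) (by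
                intro t ht
                obtain ⟨y, hy, rfl⟩ := Finset.mem_image.1 ht
                obtain ⟨h1, h2, h3, h4, h5⟩ := hmem y (Finset.mem_filter.1 hy).1
                refine ⟨by omega, h4, ?_⟩
                have : |(y.2 : ℤ) - y.1| ≤ Z := by rw [abs_le]; omega
                exact_mod_cast this)
            rwa [Int.cast_natCast] at this)
          refine this.trans (le_of_eq (by ring))
        · have := hfib (Z / x.2 + 1) (fun z hz => by
            rw [← himg z]
            have := card_le_of_dvd_sub ((T.filter (fun y => y.1 = z)).image
              (fun y : ℕ × ℕ => (y.2 : ℤ) - y.1)) x.2 (by exact_mod_cast hx2) Z (by positivity) (by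
                intro t ht t' ht'
                obtain ⟨y, hy, rfl⟩ := Finset.mem_image.1 ht
                obtain ⟨y', hy', rfl⟩ := Finset.mem_image.1 ht'
                obtain ⟨h1, h2, h3, h4, h5⟩ := hmem y (Finset.mem_filter.1 hy).1
                obtain ⟨h1', h2', h3', h4', h5'⟩ := hmem y' (Finset.mem_filter.1 hy').1
                have e1 := (Finset.mem_filter.1 hy).2
                have e2 := (Finset.mem_filter.1 hy').2
                constructor
                · have h6 := dvd_sub h5 h5'
                  have e3 : ((y₀ : ℤ) + Q * (y.1 + y.2)) - (y₀ + Q * (y'.1 + y'.2)) =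
                      Q * (((y.2 : ℤ) - y.1) - ((y'.2 : ℤ) - y'.1)) := by
                    rw [e1, e2]; ring
                  rw [e3] at h6
                  exact (Nat.isCoprime_iff_coprime.2 hcop).dvd_of_dvd_mul_left h6
                · have : ((y.2 : ℤ) - y.1) - ((y'.2 : ℤ) - y'.1) ≤ Z := by omega
                  exact_mod_cast this)
            rwa [Int.cast_natCast] at this)
          refine this.trans (le_of_eq (by ring))
    _ = 2 * (Z : ℝ) ^ 2 * ∑ x ∈ P, (((x.1 : ℝ) ^ (3 / 2 : ℝ))⁻¹ * ((x.2 : ℝ) ^ (3 / 2 : ℝ))⁻¹) +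
        Z * ∑ x ∈ P, (1 / (x.1 : ℝ) * (1 / x.2)) := by
        rw [Finset.sum_add_distrib, Finset.mul_sum, Finset.mul_sum]
    _ ≤ 2 * Z ^ 2 * ε + Z * (1 + Real.log X) ^ 2 := by
        have h1 := htail P (fun x hx => (Finset.mem_filter.1 hx).2.1)
        have h2 : ∑ x ∈ P, (1 / (x.1 : ℝ) * (1 / x.2)) ≤ (1 + Real.log X) ^ 2 := by
          calc _ ≤ ∑ x ∈ Finset.Icc 1 X ×ˢ Finset.Icc 1 X, (1 / (x.1 : ℝ) * (1 / x.2)) :=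
                Finset.sum_le_sum_of_subset_of_nonneg (Finset.filter_subset _ _)
                  (fun x _ _ => by positivity)
            _ = (∑ d ∈ Finset.Icc 1 X, (1 : ℝ) / d) ^ 2 := by
                rw [sq, Finset.sum_mul_sum, Finset.sum_product]
            _ ≤ _ := by
                gcongr
                exact sum_Icc_inv_le X
        gcongr

/-- Cauchy's inequality for the size of an image in terms of the number of collisions. -/
theorem sq_card_le_card_image_mul {α β : Type*} [DecidableEq α] [DecidableEq β] (s : Finset α)
    (f : α → β) :
    s.card ^ 2 ≤ (s.image f).card * ((s ×ˢ s).filter (fun x => f x.1 = f x.2)).card := by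
  have h1 : s.card = ∑ b ∈ s.image f, (s.filter (fun a => f a = b)).card :=
    Finset.card_eq_sum_card_fiberwise (fun a ha => Finset.mem_coe.2 (Finset.mem_image_of_mem f ha))
  have h2 : ((s ×ˢ s).filter (fun x => f x.1 = f x.2)).card =
      ∑ b ∈ s.image f, (s.filter (fun a => f a = b)).card ^ 2 := by
    rw [Finset.card_eq_sum_card_fiberwise (f := fun x : α × α => f x.1) (t := s.image f)]
    · refine Finset.sum_congr rfl fun b _ => ?_
      rw [sq, ← Finset.card_product]
      congr 1
      ext ⟨x, y⟩
      simp only [Finset.mem_filter, Finset.mem_product]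
      constructor
      · rintro ⟨⟨⟨hx, hy⟩, hxy⟩, hb⟩
        exact ⟨⟨hx, hb⟩, hy, hxy ▸ hb⟩
      · rintro ⟨⟨hx, hb⟩, hy, hb'⟩
        exact ⟨⟨⟨hx, hy⟩, hb.trans hb'.symm⟩, hb⟩
    · intro x hx
      have := (Finset.mem_product.1 (Finset.mem_filter.1 hx).1).1
      exact Finset.mem_coe.2 (Finset.mem_image_of_mem f this)
  rw [h2]
  conv_lhs => rw [h1]
  exact sq_sum_le_card_mul_sum_sq

/-- The sum of three squares with variables in arithmetic progressions to the modulus `2 * Q`. -/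
def progressionSum (Q β y₀ : ℕ) (x : ℕ × ℕ × ℕ) : ℕ :=
  (1 + 2 * Q * x.1) ^ 2 + (β + 2 * Q * x.2.1) ^ 2 + (y₀ + 2 * Q * x.2.2) ^ 2

theorem progressionSum_eq_iff {Q β y₀ i j z i' j' z' : ℕ} (hQ : 0 < Q)
    (h : progressionSum Q β y₀ (i, j, z) = progressionSum Q β y₀ (i', j', z')) :
    ((i : ℤ) - i') * (1 + Q * (i + i')) =
      ((j' : ℤ) - j) * (β + Q * (j + j')) + pairShift Q y₀ z z' := by
  have h' : ((progressionSum Q β y₀ (i, j, z) : ℕ) : ℤ) = progressionSum Q β y₀ (i', j', z') := by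
    exact_mod_cast h
  unfold progressionSum at h'
  unfold pairShift
  push_cast at h'
  have hQz : (4 * Q : ℤ) ≠ 0 := by positivity
  apply mul_left_cancel₀ hQz
  linear_combination h'

/-- The box over which the variables range. -/
def variableBox (A J Z : ℕ) : Finset (ℕ × ℕ × ℕ) :=
  Finset.range A ×ˢ Finset.range J ×ˢ Finset.range Z

theorem card_collisions_le (Q β y₀ A J Z : ℕ) (hQ : 0 < Q) :
    ((variableBox A J Z ×ˢ variableBox A J Z).filter
      (fun x => progressionSum Q β y₀ x.1 = progressionSum Q β y₀ x.2)).card ≤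
      ∑ x ∈ Finset.range Z ×ˢ Finset.range Z,
        (shiftedQuadruples Q β A J (pairShift Q y₀ x.1 x.2)).card := by
  rw [Finset.card_eq_sum_card_fiberwise
    (f := fun x : (ℕ × ℕ × ℕ) × (ℕ × ℕ × ℕ) => (x.1.2.2, x.2.2.2))
    (t := Finset.range Z ×ˢ Finset.range Z)]
  · refine Finset.sum_le_sum fun y _ => ?_
    refine Finset.card_le_card_of_injOn
      (fun x : (ℕ × ℕ × ℕ) × (ℕ × ℕ × ℕ) => ((x.1.1, x.2.1), (x.1.2.1, x.2.2.1))) ?_ ?_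
    · rintro ⟨⟨i, j, z⟩, i', j', z'⟩ hx
      simp only [variableBox, Finset.coe_filter, Finset.mem_filter, Finset.mem_product,
        Finset.mem_range, Set.mem_ofPred_eq] at hx
      obtain ⟨⟨⟨⟨h1, h2, h3⟩, h4, h5, h6⟩, h⟩, rfl⟩ := hx
      have := progressionSum_eq_iff hQ h
      simp only [shiftedQuadruples, Finset.coe_filter, Finset.mem_product,
        Finset.mem_range, Set.mem_ofPred_eq]
      exact ⟨⟨⟨h1, h4⟩, h2, h5⟩, this⟩
    · rintro ⟨⟨i, j, z⟩, i', j', z'⟩ hx ⟨⟨k, l, w⟩, k', l', w'⟩ hy h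
      have h1 := (Finset.mem_filter.1 hx).2
      have h2 := (Finset.mem_filter.1 hy).2
      have h3 := h1.trans h2.symm
      simp only [Prod.mk.injEq] at h h3 ⊢
      omega
  · rintro ⟨⟨i, j, z⟩, i', j', z'⟩ hx
    have h1 := Finset.mem_product.1 (Finset.mem_filter.1 hx).1
    simp only [variableBox, Finset.mem_product, Finset.mem_range] at h1
    simp only [Finset.coe_product, Set.mem_prod, Finset.coe_range, Set.mem_Iio]
    exact ⟨h1.1.2.2, h1.2.2.2⟩

/-- The relative error in the second moment. -/
noncomputable def momentError (q a j b z ε : ℝ) : ℝ :=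
  (1 / a + 4 * (z * (2 * q * (z + 1))) / a + 16 * q * a / j) + 24 * ε +
    12 * (1 + Real.log (2 * q * (z + 1))) ^ 2 / z +
    (b / a ^ 2) * (1 + Real.log (2 * a) + 2 * (z * (2 * q * (z + 1)))) +
    (1 / z) * (2 + 4 * (1 + Real.log (1 + 2 * q * a)) + 4 * q + 16 * q * a / j +
      (b / a ^ 2) * (1 + Real.log (2 * a)) + 4 * b / a)

theorem momentError_nonneg (Q A J B Z : ℕ) {ε : ℝ} (hε : 0 ≤ ε) (hA : 0 < A) :
    0 ≤ momentError Q A J B Z ε := by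
  have hAr : (1 : ℝ) ≤ A := by exact_mod_cast hA
  have h1 : 0 ≤ Real.log (2 * (A : ℝ)) := Real.log_nonneg (by linarith)
  have h2 : 0 ≤ Real.log (1 + 2 * (Q : ℝ) * A) := Real.log_nonneg (by
    have : (0 : ℝ) ≤ 2 * Q * A := by positivity
    linarith)
  unfold momentError
  positivity

theorem abs_pairShift_le {Q y₀ Z z z' : ℕ} (hy : y₀ ≤ 2 * Q) (hz : z < Z) (hz' : z' < Z) :
    |pairShift Q y₀ z z'| ≤ (Z * (2 * Q * (Z + 1)) : ℕ) := by
  unfold pairShift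
  rw [abs_mul]
  have h1 : |(z' : ℤ) - z| ≤ Z := by rw [abs_le]; omega
  have h2 : |(y₀ : ℤ) + Q * (z + z')| ≤ 2 * Q * (Z + 1) := by
    rw [abs_of_nonneg (by positivity)]
    have h3 : (y₀ : ℤ) ≤ 2 * Q := by exact_mod_cast hy
    have h4 : (Q : ℤ) * (z + z') ≤ Q * (2 * Z) := by
      gcongr
      omega
    linarith
  push_cast
  gcongr

theorem sum_card_shiftedQuadruples_le {Q β y₀ A J B Z W : ℕ} {ε : ℝ} (hQ : Even Q) (hQ0 : 0 < Q)
    (hB : 0 < B) (hBβ : B ≤ β) (hA : 0 < A) (hJ : 0 < J) (hZ : 0 < Z) (hy : 0 < y₀)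
    (hyQ : y₀ ≤ 2 * Q) (hKA : Z * (2 * Q * (Z + 1)) ≤ A)
    (hW : ∀ d : ℕ, d ≠ 0 → d ≠ 1 → Nat.Coprime d Q → W < d)
    (htail : ∀ t : Finset (ℕ × ℕ), (∀ x ∈ t, W < x.1 * x.2) →
      ∑ x ∈ t, (((x.1 : ℝ) ^ (3 / 2 : ℝ))⁻¹ * ((x.2 : ℝ) ^ (3 / 2 : ℝ))⁻¹) ≤ ε) :
    ∑ x ∈ Finset.range Z ×ˢ Finset.range Z,
        ((shiftedQuadruples Q β A J (pairShift Q y₀ x.1 x.2)).card : ℝ) ≤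
      (Z : ℝ) ^ 2 * (J * (A : ℝ) ^ 2 / B) * (1 + momentError Q A J B Z ε) := by
  have hAr : (1 : ℝ) ≤ A := by exact_mod_cast hA
  have hJr : (1 : ℝ) ≤ J := by exact_mod_cast hJ
  have hZr : (1 : ℝ) ≤ Z := by exact_mod_cast hZ
  have hQr : (1 : ℝ) ≤ Q := by exact_mod_cast hQ0
  have hBr : (0 : ℝ) < B := by exact_mod_cast hB
  set K : ℕ := Z * (2 * Q * (Z + 1)) with hK
  have hKr : (K : ℝ) = Z * (2 * Q * (Z + 1)) := by rw [hK]; push_cast; ring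
  set V : ℝ := J * (A : ℝ) ^ 2 / B with hV
  have hVpos : 0 < V := by positivity
  set M : ℝ := V * (1 + 1 / A + 4 * K / A + 16 * Q * A / J) + J * (1 + Real.log (2 * A)) +
    2 * J * K with hM
  have hlogA : 0 ≤ Real.log (2 * A) := Real.log_nonneg (by linarith)
  have hM0 : 0 ≤ M := by positivity
  have hoff : ∑ x ∈ (Finset.range Z).offDiag,
      ((shiftedQuadruples Q β A J (pairShift Q y₀ x.1 x.2)).card : ℝ) ≤
      (Z : ℝ) ^ 2 * M + 12 * V * (2 * Z ^ 2 * ε + Z * (1 + Real.log (2 * Q * (Z + 1))) ^ 2) := by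
    have h1 := sum_pairs_coprimeDivisors_le (Q := Q) (y₀ := y₀) (W := W) (X := 2 * Q * (Z + 1))
      (Z := Z) hy (by linarith) (by nlinarith) hW htail
    push_cast at h1
    calc _ ≤ ∑ x ∈ (Finset.range Z).offDiag,
          (M + 12 * V * ∑ d ∈ coprimeDivisors Q (pairShift Q y₀ x.1 x.2), (1 : ℝ) / d) := by
          refine Finset.sum_le_sum fun x hx => ?_
          rw [Finset.mem_offDiag, Finset.mem_range, Finset.mem_range] at hx
          refine (card_shiftedQuadruples_le_of_ne_zero (K := K) hQ hQ0 hB hBβ hA hJ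
            (pairShift_ne_zero hy hx.2.2) (abs_pairShift_le hyQ hx.1 hx.2.1) hKA).trans
            (le_of_eq ?_)
          rw [hM, hV]
          ring
      _ = (Finset.range Z).offDiag.card * M + 12 * V * ∑ x ∈ (Finset.range Z).offDiag,
          ∑ d ∈ coprimeDivisors Q (pairShift Q y₀ x.1 x.2), (1 : ℝ) / d := by
          rw [Finset.sum_add_distrib, Finset.sum_const, nsmul_eq_mul, Finset.mul_sum]
      _ ≤ _ := by
          gcongr
          have : (Finset.range Z).offDiag.card ≤ Z ^ 2 := by
            rw [Finset.offDiag_card, Finset.card_range, sq]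
            exact Nat.sub_le _ _
          exact_mod_cast this
  have hdiag : ∑ x ∈ (Finset.range Z).diag,
      ((shiftedQuadruples Q β A J (pairShift Q y₀ x.1 x.2)).card : ℝ) ≤
      Z * (V * (2 + 4 * (1 + Real.log (1 + 2 * Q * A)) + 4 * Q + 16 * Q * A / J) +
      J * (1 + Real.log (2 * A)) + 4 * J * A) := by
    rw [Finset.sum_diag]
    calc _ ≤ ∑ z ∈ Finset.range Z,
        (V * (2 + 4 * (1 + Real.log (1 + 2 * Q * A)) + 4 * Q + 16 * Q * A / J) +
        J * (1 + Real.log (2 * A)) + 4 * J * A) := by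
          refine Finset.sum_le_sum fun z _ => ?_
          have : pairShift Q y₀ z z = 0 := by unfold pairShift; ring
          simp only [this]
          exact card_shiftedQuadruples_zero_le hQ hQ0 hB hBβ hA hJ
      _ = _ := by rw [Finset.sum_const, Finset.card_range, nsmul_eq_mul]
  rw [← Finset.diag_union_offDiag, Finset.sum_union (Finset.disjoint_diag_offDiag _)]
  refine (add_le_add hdiag hoff).trans (le_of_eq ?_)
  have hJV : (J : ℝ) = V * (B / A ^ 2) := by rw [hV]; field_simp
  have e1 : (J : ℝ) * (1 + Real.log (2 * A)) = V * (B / A ^ 2) * (1 + Real.log (2 * A)) := by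
    rw [← hJV]
  have e2 : 4 * (J : ℝ) * A = V * (4 * B / A) := by rw [hV]; field_simp
  have e3 : 2 * (J : ℝ) * K = V * (B / A ^ 2) * (2 * K) := by rw [← hJV]; ring
  rw [hM, e1, e2, e3, hKr]
  unfold momentError
  have hZ0 : (Z : ℝ) ≠ 0 := by positivity
  generalize Real.log (2 * A) = l1
  generalize Real.log (1 + 2 * Q * A) = l2
  generalize Real.log (2 * Q * (Z + 1)) = l3
  generalize V = v
  generalize 16 * (Q : ℝ) * A / J = t1
  generalize (B : ℝ) / A ^ 2 = t2
  generalize 4 * (B : ℝ) / A = t3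
  field_simp
  ring

/-- The number of integers of a residue class that are not represented. -/
theorem card_not_represented_le {Q β y₀ A J B Z W : ℕ} {ε : ℝ} (hQ : Even Q) (hQ0 : 0 < Q)
    (hB : 0 < B) (hBβ : B ≤ β) (hβB : β ≤ B + 2 * Q) (hA : 0 < A) (hJ : 0 < J) (hZ : 0 < Z)
    (hy : 0 < y₀) (hyQ : y₀ ≤ 2 * Q) (hKA : Z * (2 * Q * (Z + 1)) ≤ A)
    (hW : ∀ d : ℕ, d ≠ 0 → d ≠ 1 → Nat.Coprime d Q → W < d) (hε : 0 ≤ ε)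
    (htail : ∀ t : Finset (ℕ × ℕ), (∀ x ∈ t, W < x.1 * x.2) →
      ∑ x ∈ t, (((x.1 : ℝ) ^ (3 / 2 : ℝ))⁻¹ * ((x.2 : ℝ) ^ (3 / 2 : ℝ))⁻¹) ≤ ε)
    (c : ℤ) (hc : (4 * Q : ℤ) ∣ 1 + (β : ℤ) ^ 2 + (y₀ : ℤ) ^ 2 - c) (S : Finset ℕ)
    (hS : ∀ n ∈ S, B ^ 2 < n ∧ n ≤ (B + 2 * Q * J) ^ 2 ∧ (4 * Q : ℤ) ∣ n - c ∧
      ∀ i j z, z < Z → n ≠ progressionSum Q β y₀ (i, j, z)) :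
    (S.card : ℝ) ≤ B * J * momentError Q A J B Z ε + B + Q * ((J : ℝ) + 1) ^ 2 + Q * (A : ℝ) ^ 2 +
      Q * ((Z : ℝ) + 1) ^ 2 + 1 := by
  have hAr : (1 : ℝ) ≤ A := by exact_mod_cast hA
  have hJr : (1 : ℝ) ≤ J := by exact_mod_cast hJ
  have hZr : (1 : ℝ) ≤ Z := by exact_mod_cast hZ
  have hQr : (1 : ℝ) ≤ Q := by exact_mod_cast hQ0
  have hBr : (0 : ℝ) < B := by exact_mod_cast hB
  set I := (variableBox A J Z).image (progressionSum Q β y₀) with hI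
  have herr : 0 ≤ momentError Q A J B Z ε := momentError_nonneg Q A J B Z hε hA
  have hIcard : (B : ℝ) * J * (1 - momentError Q A J B Z ε) ≤ I.card := by
    have h1 := sq_card_le_card_image_mul (variableBox A J Z) (progressionSum Q β y₀)
    have h2 := sum_card_shiftedQuadruples_le (β := β) hQ hQ0 hB hBβ hA hJ hZ hy hyQ hKA hW htail
    have h3 : (((variableBox A J Z ×ˢ variableBox A J Z).filter
      (fun x => progressionSum Q β y₀ x.1 = progressionSum Q β y₀ x.2)).card : ℝ) ≤
        (Z : ℝ) ^ 2 * (J * (A : ℝ) ^ 2 / B) * (1 + momentError Q A J B Z ε) := by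
      refine le_trans ?_ h2
      exact_mod_cast card_collisions_le Q β y₀ A J Z hQ0
    have h4 : ((variableBox A J Z).card : ℝ) = A * (J * Z) := by
      unfold variableBox
      simp
    have h5 : ((A : ℝ) * (J * Z)) ^ 2 ≤
        I.card * ((Z : ℝ) ^ 2 * (J * (A : ℝ) ^ 2 / B) * (1 + momentError Q A J B Z ε)) := by
      calc ((A : ℝ) * (J * Z)) ^ 2 = ((variableBox A J Z).card : ℝ) ^ 2 := by rw [h4]
        _ ≤ I.card * (((variableBox A J Z ×ˢ variableBox A J Z).filter
          (fun x => progressionSum Q β y₀ x.1 = progressionSum Q β y₀ x.2)).card : ℝ) := by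
            exact_mod_cast h1
        _ ≤ _ := by gcongr
    have h6 : (B : ℝ) * J ≤ I.card * (1 + momentError Q A J B Z ε) := by
      have hpos : (0 : ℝ) < Z ^ 2 * (J * (A : ℝ) ^ 2 / B) := by positivity
      refine le_of_mul_le_mul_left ?_ hpos
      calc (Z : ℝ) ^ 2 * (J * (A : ℝ) ^ 2 / B) * (B * J) = ((A : ℝ) * (J * Z)) ^ 2 := by
            field_simp
        _ ≤ _ := h5
        _ = _ := by ring
    generalize momentError Q A J B Z ε = e at herr h6 ⊢
    have hBJ : 0 < (B : ℝ) * J := by positivity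
    have h7 : (B : ℝ) * J / (1 + e) ≤ I.card := by
      rw [div_le_iff₀ (by positivity)]
      exact h6
    refine le_trans ?_ h7
    rw [le_div_iff₀ (by positivity)]
    nlinarith [mul_nonneg hBJ.le (sq_nonneg e)]
  set U : ℕ := (B + 2 * Q * (J + 1)) ^ 2 + (2 * Q * A) ^ 2 + (2 * Q * (Z + 1)) ^ 2 with hU
  have hImem : ∀ n ∈ I, B ^ 2 < n ∧ n ≤ U ∧ (4 * Q : ℤ) ∣ n - c := by
    intro n hn
    obtain ⟨⟨i, j, z⟩, hx, rfl⟩ := Finset.mem_image.1 hn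
    simp only [variableBox, Finset.mem_product, Finset.mem_range] at hx
    obtain ⟨hi, hj, hz⟩ := hx
    refine ⟨?_, ?_, ?_⟩
    · unfold progressionSum
      have h1 : B ^ 2 ≤ (β + 2 * Q * j) ^ 2 := Nat.pow_le_pow_left (by nlinarith) 2
      have h2 : 0 < (1 + 2 * Q * i) ^ 2 := by positivity
      simp only
      omega
    · unfold progressionSum
      have h1 : (β + 2 * Q * j) ^ 2 ≤ (B + 2 * Q * (J + 1)) ^ 2 :=
        Nat.pow_le_pow_left (by nlinarith) 2
      have h2 : (1 + 2 * Q * i) ^ 2 ≤ (2 * Q * A) ^ 2 := Nat.pow_le_pow_left (by nlinarith) 2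
      have h3 : (y₀ + 2 * Q * z) ^ 2 ≤ (2 * Q * (Z + 1)) ^ 2 :=
        Nat.pow_le_pow_left (by nlinarith) 2
      simp only
      omega
    · obtain ⟨t, ht⟩ := hc
      obtain ⟨q, hq⟩ := hQ
      refine ⟨t + i + Q * i ^ 2 + β * j + Q * j ^ 2 + y₀ * z + Q * z ^ 2, ?_⟩
      unfold progressionSum
      push_cast
      linear_combination ht
  have hdisj : Disjoint S I := by
    rw [Finset.disjoint_left]
    intro n hn hnI
    obtain ⟨⟨i, j, z⟩, hx, rfl⟩ := Finset.mem_image.1 hnI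
    simp only [variableBox, Finset.mem_product, Finset.mem_range] at hx
    exact (hS _ hn).2.2.2 i j z hx.2.2 rfl
  have hunion : ∀ n ∈ S ∪ I, B ^ 2 < n ∧ n ≤ U ∧ (4 * Q : ℤ) ∣ n - c := by
    intro n hn
    rcases Finset.mem_union.1 hn with h | h
    · obtain ⟨h1, h2, h3, -⟩ := hS n h
      refine ⟨h1, h2.trans ?_, h3⟩
      have : (B + 2 * Q * J) ^ 2 ≤ (B + 2 * Q * (J + 1)) ^ 2 :=
        Nat.pow_le_pow_left (by nlinarith) 2
      omega
    · exact hImem n h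
  have himg : ((S ∪ I).image (fun n : ℕ => (n : ℤ))).card = S.card + I.card := by
    rw [Finset.card_image_of_injective _ Nat.cast_injective, Finset.card_union_of_disjoint hdisj]
  have hUB : B ^ 2 ≤ U := by
    have : B ^ 2 ≤ (B + 2 * Q * (J + 1)) ^ 2 := Nat.pow_le_pow_left (by nlinarith) 2
    omega
  have hUBr : (B : ℝ) ^ 2 ≤ U := by exact_mod_cast hUB
  have hcount := card_le_of_dvd_sub ((S ∪ I).image (fun n : ℕ => (n : ℤ))) (4 * Q) (by positivity)
    ((U : ℝ) - B ^ 2) (by linarith) (by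
      intro x hx y hy
      obtain ⟨n, hn, rfl⟩ := Finset.mem_image.1 hx
      obtain ⟨m, hm, rfl⟩ := Finset.mem_image.1 hy
      obtain ⟨h1, h2, h3⟩ := hunion n hn
      obtain ⟨h1', h2', h3'⟩ := hunion m hm
      constructor
      · have := dvd_sub h3 h3'
        rwa [sub_sub_sub_cancel_right] at this
      · have e1 : (n : ℝ) ≤ U := by exact_mod_cast h2
        have e2 : (B : ℝ) ^ 2 ≤ m := by exact_mod_cast h1'.le
        push_cast
        linarith)
  rw [himg] at hcount
  push_cast at hcount
  have hUr : (U : ℝ) = (B + 2 * Q * (J + 1)) ^ 2 + (2 * Q * A) ^ 2 + (2 * Q * (Z + 1)) ^ 2 := by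
    rw [hU]; push_cast; ring
  have hfin : ((U : ℝ) - B ^ 2) / (4 * Q) = B * (J + 1) + Q * ((J : ℝ) + 1) ^ 2 + Q * (A : ℝ) ^ 2 +
      Q * ((Z : ℝ) + 1) ^ 2 := by
    rw [hUr]
    field_simp
    ring
  rw [hfin] at hcount
  linarith

theorem tendsto_one_add_log_sq_div (q : ℝ) (hq : 0 < q) :
    Tendsto (fun t : ℝ => (1 + Real.log (2 * q * (t + 1))) ^ 2 / t) atTop (𝓝 0) := by
  have hv : Tendsto (fun t : ℝ => 2 * q * (t + 1)) atTop atTop :=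
    (tendsto_atTop_add_const_right _ 1 tendsto_id).const_mul_atTop (by positivity)
  have h1 : Tendsto (fun v : ℝ => (1 + Real.log v) ^ 2 / v) atTop (𝓝 0) := by
    have e0 : Tendsto (fun v : ℝ => 1 / v) atTop (𝓝 0) := by
      simpa using tendsto_inv_atTop_zero (𝕜 := ℝ)
    have e1 : Tendsto (fun v : ℝ => Real.log v ^ 1 / v) atTop (𝓝 0) :=
      (Real.isLittleO_pow_log_id_atTop (n := 1)).tendsto_div_nhds_zero
    have e2 : Tendsto (fun v : ℝ => Real.log v ^ 2 / v) atTop (𝓝 0) :=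
      (Real.isLittleO_pow_log_id_atTop (n := 2)).tendsto_div_nhds_zero
    have := (e0.add (e1.const_mul 2)).add e2
    simp only [mul_zero, add_zero] at this
    refine this.congr fun v => ?_
    ring
  have h2 : Tendsto (fun t : ℝ => 2 * q * (1 + 1 / t)) atTop (𝓝 (2 * q * (1 + 0))) := by
    refine Tendsto.const_mul _ (Tendsto.const_add _ ?_)
    exact tendsto_inv_atTop_zero.congr fun t => (one_div t).symm
  have h3 := (h1.comp hv).mul h2
  rw [zero_mul] at h3
  refine h3.congr' ?_
  filter_upwards [eventually_gt_atTop 0] with t ht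
  have : t + 1 ≠ 0 := by positivity
  simp only [Function.comp]
  field_simp

/-- The total relative error is small for a suitable choice of parameters. -/
theorem exists_parameters (Q : ℕ) (hQ0 : 0 < Q) (η : ℝ) (hη : 0 < η) (hη1 : η ≤ 1) :
    ∃ κ : ℝ, ∀ᶠ E : ℕ in atTop, ∃ A J B Z : ℕ, 0 < A ∧ 0 < J ∧ 0 < B ∧ 0 < Z ∧
      B + 2 * Q * J = E ∧ E ≤ B ^ 2 ∧ Z * (2 * Q * (Z + 1)) ≤ A ∧
      2 * (Q : ℝ) * Z ≤ κ * Real.log E ∧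
      2 * (B * J * momentError Q A J B Z (η / 480) + B + Q * ((J : ℝ) + 1) ^ 2 + Q * (A : ℝ) ^ 2 +
        Q * ((Z : ℝ) + 1) ^ 2 + 1) ≤ η * (B * J) := by
  have hQr : (1 : ℝ) ≤ Q := by exact_mod_cast hQ0
  obtain ⟨δ, hδ⟩ : ∃ δ, δ = η / (40 * Q) := ⟨_, rfl⟩
  obtain ⟨α, hα⟩ : ∃ α, α = δ * η / (320 * Q) := ⟨_, rfl⟩
  obtain ⟨μ, hμ⟩ : ∃ μ, μ = 80 / η := ⟨_, rfl⟩
  obtain ⟨γ, hγ⟩ : ∃ γ, γ = 1 - 2 * Q * δ := ⟨_, rfl⟩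
  have hδpos : 0 < δ := by rw [hδ]; positivity
  have hαpos : 0 < α := by rw [hα]; positivity
  have hμpos : 0 < μ := by rw [hμ]; positivity
  have hQδ : (Q : ℝ) * δ = η / 40 := by rw [hδ]; field_simp
  have hγ2 : 1 / 2 ≤ γ := by rw [hγ, mul_assoc, hQδ]; linarith
  have hγpos : 0 < γ := by linarith
  let A : ℕ → ℕ := fun E => ⌊α * (E : ℝ)⌋₊
  let J : ℕ → ℕ := fun E => ⌊δ * (E : ℝ)⌋₊
  let B : ℕ → ℕ := fun E => E - 2 * Q * J E
  let Z : ℕ → ℕ := fun E => ⌈μ * Real.log E⌉₊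
  have hE : Tendsto (fun E : ℕ => (E : ℝ)) atTop atTop := tendsto_natCast_atTop_atTop
  have hL : Tendsto (fun E : ℕ => Real.log E) atTop atTop := Real.tendsto_log_atTop.comp hE
  have ha : Tendsto (fun E : ℕ => (A E : ℝ) / E) atTop (𝓝 α) :=
    (tendsto_nat_floor_mul_div_atTop hαpos.le).comp hE
  have hj : Tendsto (fun E : ℕ => (J E : ℝ) / E) atTop (𝓝 δ) :=
    (tendsto_nat_floor_mul_div_atTop hδpos.le).comp hE
  have hBJ : ∀ E, B E + 2 * Q * J E = E := by
    intro E
    have h1 : (J E : ℝ) ≤ δ * E := Nat.floor_le (by positivity)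
    have h2 : ((2 * Q * J E : ℕ) : ℝ) ≤ E := by
      push_cast
      calc 2 * (Q : ℝ) * J E ≤ 2 * Q * (δ * E) := by gcongr
        _ = 2 * (Q * δ) * E := by ring
        _ ≤ 1 * E := by gcongr; rw [hQδ]; linarith
        _ = E := one_mul _
    have h3 : 2 * Q * J E ≤ E := by exact_mod_cast h2
    simp only [B]
    omega
  have hBr : ∀ E, (B E : ℝ) = E - 2 * Q * J E := by
    intro E
    have : ((B E + 2 * Q * J E : ℕ) : ℝ) = E := by rw [hBJ]
    push_cast at this
    linarith
  have hb : Tendsto (fun E : ℕ => (B E : ℝ) / E) atTop (𝓝 γ) := by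
    have := (hj.const_mul (2 * (Q : ℝ))).const_sub 1
    rw [← hγ] at this
    refine this.congr' ?_
    filter_upwards [eventually_gt_atTop 0] with E hE0
    have : (E : ℝ) ≠ 0 := by positivity
    rw [hBr]
    field_simp
  have hz : Tendsto (fun E : ℕ => (Z E : ℝ) / Real.log E) atTop (𝓝 μ) :=
    (tendsto_nat_ceil_mul_div_atTop hμpos.le).comp hL
  have hA : Tendsto (fun E => (A E : ℝ)) atTop atTop := by
    refine (hE.atTop_mul_pos hαpos ha).congr' ?_
    filter_upwards [eventually_gt_atTop 0] with E hE0
    field_simp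
  have hJ : Tendsto (fun E => (J E : ℝ)) atTop atTop := by
    refine (hE.atTop_mul_pos hδpos hj).congr' ?_
    filter_upwards [eventually_gt_atTop 0] with E hE0
    field_simp
  have hB : Tendsto (fun E => (B E : ℝ)) atTop atTop := by
    refine (hE.atTop_mul_pos hγpos hb).congr' ?_
    filter_upwards [eventually_gt_atTop 0] with E hE0
    field_simp
  have hZ : Tendsto (fun E => (Z E : ℝ)) atTop atTop := by
    refine (hL.atTop_mul_pos hμpos hz).congr' ?_
    filter_upwards [hL.eventually_gt_atTop 0] with E hE0
    field_simp
  have hs0 : Tendsto (fun E : ℕ => 1 / (E : ℝ)) atTop (𝓝 0) := tendsto_one_div_atTop_nhds_zero_nat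
  have hlog1 : Tendsto (fun v : ℝ => Real.log v / v) atTop (𝓝 0) := by
    have := (Real.isLittleO_pow_log_id_atTop (n := 1)).tendsto_div_nhds_zero
    simpa using this
  have hlog2 : Tendsto (fun v : ℝ => Real.log v ^ 2 / v) atTop (𝓝 0) :=
    (Real.isLittleO_pow_log_id_atTop (n := 2)).tendsto_div_nhds_zero
  have hz1 : Tendsto (fun E : ℕ => (Z E : ℝ) / E) atTop (𝓝 0) := by
    have := hz.mul (hlog1.comp hE)
    rw [mul_zero] at this
    refine this.congr' ?_
    filter_upwards [hL.eventually_gt_atTop 0] with E hE0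
    simp only [Function.comp]
    field_simp
  have hz2 : Tendsto (fun E : ℕ => (Z E : ℝ) ^ 2 / E) atTop (𝓝 0) := by
    have := (hz.pow 2).mul (hlog2.comp hE)
    rw [mul_zero] at this
    refine this.congr' ?_
    filter_upwards [hL.eventually_gt_atTop 0] with E hE0
    simp only [Function.comp]
    field_simp
  have hk : Tendsto (fun E : ℕ => (Z E * (2 * Q * (Z E + 1)) : ℝ) / E) atTop (𝓝 0) := by
    have := (hz2.add hz1).const_mul (2 * (Q : ℝ))
    simp only [add_zero, mul_zero] at this
    refine this.congr fun E => ?_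
    ring
  have hm : Tendsto (fun E : ℕ => Real.log (2 * A E) / E) atTop (𝓝 0) := by
    have h1 := hlog1.comp (hA.const_mul_atTop (two_pos))
    have := h1.mul (ha.const_mul 2)
    rw [zero_mul] at this
    refine this.congr' ?_
    filter_upwards [hA.eventually_gt_atTop 0] with E hE0
    simp only [Function.comp]
    field_simp
  have hzi : Tendsto (fun E : ℕ => 1 / (Z E : ℝ)) atTop (𝓝 0) := by
    simp only [one_div]
    exact hZ.inv_tendsto_atTop
  have hlq : Tendsto (fun E : ℕ => Real.log (1 + 2 * Q * A E) / Z E) atTop (𝓝 (1 / μ)) := by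
    have h1 : Tendsto (fun E : ℕ => 1 / (E : ℝ) + 2 * Q * ((A E : ℝ) / E)) atTop
        (𝓝 (0 + 2 * Q * α)) := hs0.add (ha.const_mul _)
    have h2 := h1.log (by positivity)
    have h3 := (h2.mul hzi).add ((hz.inv₀ hμpos.ne'))
    rw [mul_zero, zero_add, ← one_div] at h3
    refine h3.congr' ?_
    filter_upwards [hL.eventually_gt_atTop 0, hZ.eventually_gt_atTop 0,
      eventually_gt_atTop 0] with E hE0 hZ0 hE1
    have hEr : (0 : ℝ) < E := by exact_mod_cast hE1
    have e : 1 / (E : ℝ) + 2 * Q * ((A E : ℝ) / E) = (1 + 2 * Q * A E) / E := by field_simp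
    rw [e, Real.log_div (by positivity) hEr.ne']
    field_simp
    ring
  have hg : Tendsto (fun E : ℕ => (1 + Real.log (2 * Q * ((Z E : ℝ) + 1))) ^ 2 / Z E) atTop (𝓝 0) :=
    (tendsto_one_add_log_sq_div Q (by positivity)).comp hZ
  have hzz : Tendsto (fun E : ℕ => ((Z E : ℝ) + 1) ^ 2 / E) atTop (𝓝 0) := by
    have := (hz2.add (hz1.const_mul 2)).add hs0
    simp only [add_zero, mul_zero] at this
    refine this.congr fun E => ?_
    ring
  have haj := (ha.div hj hδpos.ne').const_mul (16 * (Q : ℝ))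
  have hba2 := hb.div (ha.pow 2) (pow_ne_zero 2 hαpos.ne')
  have hba := (hb.div ha hαpos.ne').const_mul 4
  have hbj := hb.mul hj
  have hbj0 : γ * δ ≠ 0 := by positivity
  have t1 := ((hs0.div ha hαpos.ne').add ((hk.div ha hαpos.ne').const_mul 4)).add haj
  have t2 := hg.const_mul 12
  have t3 := hba2.mul ((hs0.add hm).add (hk.const_mul 2))
  have t4 := (hzi.mul (((haj.const_add (2 + 4 + 4 * (Q : ℝ))).add (hba2.mul (hs0.add hm))).add
    hba)).add (hlq.const_mul 4)
  have t5 := ((((hs0.div hj hδpos.ne').add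
    ((((hj.add hs0).pow 2).const_mul (Q : ℝ)).div hbj hbj0)).add
    (((ha.pow 2).const_mul (Q : ℝ)).div hbj hbj0)).add
    (((hzz.mul hs0).const_mul (Q : ℝ)).div hbj hbj0)).add ((hs0.pow 2).div hbj hbj0)
  have htot := ((((t1.add_const (24 * (η / 480))).add t2).add t3).add t4).add t5
  have hlt := htot.eventually_lt_const (u := η / 2) (by
    have e1 : α / δ = η / (320 * Q) := by rw [hα]; field_simp
    have e2 : 16 * (Q : ℝ) * (α / δ) = η / 20 := by rw [e1]; field_simp; norm_num
    have e3 : 4 * (1 / μ) = η / 20 := by rw [hμ]; field_simp; norm_num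
    have e4 : (Q : ℝ) * (δ + 0) ^ 2 / (γ * δ) ≤ η / 20 := by
      have : (Q : ℝ) * (δ + 0) ^ 2 / (γ * δ) = Q * δ / γ := by
        rw [add_zero]; field_simp
      rw [this, hQδ, div_le_iff₀ hγpos]
      nlinarith
    have e5 : (Q : ℝ) * α ^ 2 / (γ * δ) ≤ η / 160 := by
      have h1 : (Q : ℝ) * α ^ 2 / (γ * δ) = (Q * (α / δ)) * α / γ := by field_simp
      have h2 : (Q : ℝ) * (α / δ) = η / 320 := by rw [e1]; field_simp
      have h3 : α ≤ 1 := by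
        rw [hα, div_le_one (by positivity)]
        have : (Q : ℝ) * δ * η ≤ 1 := by rw [hQδ]; nlinarith
        nlinarith
      rw [h1, h2, div_le_iff₀ hγpos]
      nlinarith
    rw [e2, e3]
    simp only [zero_div, mul_zero, zero_mul, add_zero, zero_add, ne_eq, OfNat.ofNat_ne_zero,
      not_false_eq_true, zero_pow] at e4 ⊢
    linarith)
  refine ⟨2 * Q * (2 * μ), ?_⟩
  filter_upwards [hlt, hA.eventually_gt_atTop 0, hJ.eventually_gt_atTop 0,
    hB.eventually_gt_atTop 0, hZ.eventually_gt_atTop 0, eventually_gt_atTop 0,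
    (hk.div ha hαpos.ne').eventually_lt_const (u := 1) (by simp),
    (hB.atTop_mul_pos hγpos hb).eventually_ge_atTop 1,
    hz.eventually_lt_const (u := 2 * μ) (by linarith), hL.eventually_gt_atTop 0]
    with E h1 hA0 hJ0 hB0 hZ0 hE0 hk1 hBB hz0 hL0
  have hEr : (0 : ℝ) < E := by exact_mod_cast hE0
  refine ⟨A E, J E, B E, Z E, by exact_mod_cast hA0, by exact_mod_cast hJ0, by exact_mod_cast hB0,
    by exact_mod_cast hZ0, hBJ E, ?_, ?_, ?_, ?_⟩
  · rw [← mul_div_assoc, le_div_iff₀ hEr, one_mul, ← sq] at hBB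
    exact_mod_cast hBB
  · rw [Pi.div_apply, div_div_div_cancel_right₀ hEr.ne', div_lt_one hA0] at hk1
    exact_mod_cast hk1.le
  · rw [div_lt_iff₀ hL0] at hz0
    calc 2 * (Q : ℝ) * Z E ≤ 2 * Q * (2 * μ * Real.log E) := by gcongr
      _ = _ := by ring
  · have hBJpos : (0 : ℝ) < B E * J E := by positivity
    have h2 : 2 * (momentError Q (A E) (J E) (B E) (Z E) (η / 480) + (1 / J E +
        Q * ((J E : ℝ) + 1) ^ 2 / (B E * J E) + Q * (A E : ℝ) ^ 2 / (B E * J E) +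
        Q * ((Z E : ℝ) + 1) ^ 2 / (B E * J E) + 1 / (B E * J E))) ≤ η := by
      have : momentError Q (A E) (J E) (B E) (Z E) (η / 480) + (1 / J E +
        Q * ((J E : ℝ) + 1) ^ 2 / (B E * J E) + Q * (A E : ℝ) ^ 2 / (B E * J E) +
        Q * ((Z E : ℝ) + 1) ^ 2 / (B E * J E) + 1 / (B E * J E)) < η / 2 := by
        refine lt_of_eq_of_lt ?_ h1
        unfold momentError
        simp only [Pi.div_apply]
        generalize Real.log (2 * (A E : ℝ)) = l1
        generalize Real.log (1 + 2 * Q * (A E : ℝ)) = l2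
        generalize Real.log (2 * Q * ((Z E : ℝ) + 1)) = l3
        refine congrArg₂ (· + ·) (congrArg₂ (· + ·) (congrArg₂ (· + ·) (congrArg₂ (· + ·)
          (congrArg₂ (· + ·) ?_ ?_) ?_) ?_) ?_) ?_
        · field_simp
        · rfl
        · ring
        · field_simp
        · field_simp
          ring
        · field_simp
      linarith
    calc _ = 2 * (momentError Q (A E) (J E) (B E) (Z E) (η / 480) + (1 / J E +
        Q * ((J E : ℝ) + 1) ^ 2 / (B E * J E) + Q * (A E : ℝ) ^ 2 / (B E * J E) +
        Q * ((Z E : ℝ) + 1) ^ 2 / (B E * J E) + 1 / (B E * J E))) * (B E * J E) := by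
          generalize momentError Q (A E) (J E) (B E) (Z E) (η / 480) = e
          field_simp
          ring
      _ ≤ _ := by gcongr

/-- Representatives of a residue class in a prescribed interval of natural numbers. -/
theorem exists_nat_modEq (m : ℕ) (hm : 0 < m) (L : ℕ) (b : ℤ) :
    ∃ β : ℕ, L ≤ β ∧ β < L + m ∧ (m : ℤ) ∣ β - b := by
  have hmz : (0 : ℤ) < m := by exact_mod_cast hm
  have h1 := Int.emod_nonneg (b - L) hmz.ne'
  have h2 := Int.emod_lt_of_pos (b - L) hmz
  refine ⟨L + ((b - L) % m).toNat, by omega, by omega, ?_⟩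
  have h3 : (((b - L) % m).toNat : ℤ) = (b - L) % m := Int.toNat_of_nonneg h1
  push_cast
  rw [h3]
  exact ⟨-((b - L) / m), by linarith [Int.emod_add_mul_ediv (b - L) m]⟩

/-- The exceptional set is sparse in suitable intervals between squares, as soon as the admissible
size of the small variable grows faster than the logarithm. -/
theorem exists_sparse_window (Y : ℕ → ℝ) (hY : ∀ κ : ℝ, ∀ᶠ n : ℕ in atTop, κ * Real.log n ≤ Y n)
    (η : ℝ) (hη : 0 < η) (hη1 : η ≤ 1) :
    ∀ᶠ E : ℕ in atTop, ∃ B : ℕ, B + 2 ≤ E ∧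
      (({n : ℕ | ¬ 4 ∣ n ∧ ¬ n ≡ 7 [MOD 8] ∧ ¬ IsMicrosquareSum n (Y n)} ∩
        Set.Ioc (B ^ 2) (E ^ 2)).ncard : ℝ) ≤ η * (B * ((E : ℝ) - B)) := by
  classical
  obtain ⟨W0, hW0⟩ := exists_tail_bound (η / 480) (by positivity)
  obtain ⟨W, hWW, hW2⟩ : ∃ W, W0 ≤ W ∧ 2 ≤ W := ⟨max W0 2, le_max_left _ _, le_max_right _ _⟩
  obtain ⟨Q, hQ⟩ : ∃ Q, Q = primorial W := ⟨_, rfl⟩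
  have hQ0 : 0 < Q := hQ ▸ primorial_pos W
  have hQe : Even Q := hQ ▸ (even_iff_two_dvd.2 (Nat.prime_two.dvd_primorial_iff.2 hW2))
  have hWcop : ∀ d : ℕ, d ≠ 0 → d ≠ 1 → Nat.Coprime d Q → W < d := by
    intro d h0 h1 h2
    exact (lt_of_coprime_primorial h1 (hQ ▸ h2)).resolve_right h0
  have htail : ∀ t : Finset (ℕ × ℕ), (∀ x ∈ t, W < x.1 * x.2) →
      ∑ x ∈ t, (((x.1 : ℝ) ^ (3 / 2 : ℝ))⁻¹ * ((x.2 : ℝ) ^ (3 / 2 : ℝ))⁻¹) ≤ η / 480 :=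
    fun t ht => hW0 t (fun x hx => lt_of_le_of_lt hWW (ht x hx))
  obtain ⟨κ, hκ⟩ := exists_parameters Q hQ0 η hη hη1
  obtain ⟨N0, hN0⟩ := eventually_atTop.1 (hY (max κ 0))
  filter_upwards [hκ, eventually_ge_atTop N0, eventually_ge_atTop 1] with E hE hEN hE1
  obtain ⟨A, J, B, Z, hA, hJ, hB, hZ, hBE, hEB, hKA, hZκ, hfin⟩ := hE
  have hBr : (0 : ℝ) < B := by exact_mod_cast hB
  have hJr : (0 : ℝ) < J := by exact_mod_cast hJ
  have hEr : (E : ℝ) = B + 2 * Q * J := by rw [← hBE]; push_cast; ring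
  refine ⟨B, by nlinarith, ?_⟩
  set T := (Finset.Ioc (B ^ 2) (E ^ 2)).filter
    (fun n => ¬ 4 ∣ n ∧ ¬ n ≡ 7 [MOD 8] ∧ ¬ IsMicrosquareSum n (Y n)) with hT
  have hTset : ({n : ℕ | ¬ 4 ∣ n ∧ ¬ n ≡ 7 [MOD 8] ∧ ¬ IsMicrosquareSum n (Y n)} ∩
        Set.Ioc (B ^ 2) (E ^ 2)) = (T : Set ℕ) := by
    ext n
    simp only [hT, Finset.coe_filter, Finset.mem_Ioc, Set.mem_inter_iff, Set.mem_ofPred_eq,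
      Set.mem_Ioc]
    tauto
  rw [hTset, Set.ncard_coe_finset]
  obtain ⟨M, hM⟩ : ∃ M : ℝ, M = B * J * momentError Q A J B Z (η / 480) + B +
    Q * ((J : ℝ) + 1) ^ 2 + Q * (A : ℝ) ^ 2 + Q * ((Z : ℝ) + 1) ^ 2 + 1 := ⟨_, rfl⟩
  rw [← hM] at hfin
  have hM0 : 0 ≤ M := by
    have := momentError_nonneg Q A J B Z (ε := η / 480) (by positivity) hA
    rw [hM]
    positivity
  have hclass : ∀ c ∈ Finset.range (4 * Q), ((T.filter (fun n => n % (4 * Q) = c)).card : ℝ) ≤ M := by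
    intro c _
    rcases (T.filter (fun n => n % (4 * Q) = c)).eq_empty_or_nonempty with h | ⟨n₀, hn₀⟩
    · rw [h]; simpa using hM0
    rw [Finset.mem_filter, hT, Finset.mem_filter] at hn₀
    obtain ⟨⟨-, h4, h7, -⟩, hc⟩ := hn₀
    obtain ⟨b, y, hby⟩ := exists_local_solution hW2 h4 h7
    rw [← hQ] at hby
    obtain ⟨β, hβ1, hβ2, s, hs⟩ := exists_nat_modEq (2 * Q) (by positivity) B b
    obtain ⟨y₀, hy1, hy2, t, ht⟩ := exists_nat_modEq (2 * Q) (by positivity) 1 y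
    push_cast at hs ht
    rw [hM]
    refine card_not_represented_le (β := β) (y₀ := y₀) (W := W) hQe hQ0 hB hβ1 hβ2.le hA hJ hZ
      (by omega) (by omega) hKA hWcop (by positivity) htail n₀ ?_ _ ?_
    · obtain ⟨r, hr⟩ := hby
      have e1 : (β : ℤ) = b + 2 * Q * s := by linarith
      have e2 : (y₀ : ℤ) = y + 2 * Q * t := by linarith
      refine ⟨r + b * s + Q * s ^ 2 + y * t + Q * t ^ 2, ?_⟩
      rw [e1, e2]
      linear_combination hr
    · intro n hn
      rw [Finset.mem_filter, hT, Finset.mem_filter, Finset.mem_Ioc] at hn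
      obtain ⟨⟨⟨hn1, hn2⟩, -, -, hnot⟩, hnc⟩ := hn
      refine ⟨hn1, by rw [hBE]; exact hn2, ?_, ?_⟩
      · have h1 : n₀ ≡ n [MOD 4 * Q] := hc.trans hnc.symm
        have := h1.dvd
        push_cast at this
        exact this
      · intro i j z hz hrep
        refine hnot ⟨1 + 2 * Q * i, β + 2 * Q * j, y₀ + 2 * Q * z, by positivity, by omega,
          by omega, hrep, ?_⟩
        have hEn : E ≤ n := hEB.trans hn1.le
        have h1 : ((y₀ + 2 * Q * z : ℕ) : ℝ) ≤ 2 * Q * Z := by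
          have h2 : y₀ + 2 * Q * z ≤ 2 * Q * Z := by
            have h3 : 2 * Q * (z + 1) ≤ 2 * Q * Z := Nat.mul_le_mul_left _ hz
            rw [Nat.mul_add] at h3
            omega
          exact_mod_cast h2
        have hlogE : 0 ≤ Real.log E := Real.log_nonneg (by exact_mod_cast hE1)
        have hlog : Real.log E ≤ Real.log n :=
          Real.log_le_log (by exact_mod_cast hE1) (by exact_mod_cast hEn)
        calc ((y₀ + 2 * Q * z : ℕ) : ℝ) ≤ κ * Real.log E := h1.trans hZκ
          _ ≤ max κ 0 * Real.log E := by gcongr; exact le_max_left _ _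
          _ ≤ max κ 0 * Real.log n := by gcongr
          _ ≤ Y n := hN0 n (hEN.trans hEn)
  have hsum : (T.card : ℝ) ≤ 4 * Q * M := by
    rw [Finset.card_eq_sum_card_fiberwise (f := fun n => n % (4 * Q)) (t := Finset.range (4 * Q))
      (fun n _ => by
        simp only [Finset.coe_range, Set.mem_Iio]
        exact Nat.mod_lt _ (by positivity))]
    push_cast
    calc _ ≤ ∑ c ∈ Finset.range (4 * Q), M := Finset.sum_le_sum hclass
      _ = _ := by rw [Finset.sum_const, Finset.card_range, nsmul_eq_mul]; push_cast; ring
  calc (T.card : ℝ) ≤ 2 * Q * (2 * M) := hsum.trans (le_of_eq (by ring))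
    _ ≤ 2 * Q * (η * (B * J)) := by gcongr
    _ = _ := by rw [hEr]; ring

/-- The admissible size of the small variable grows faster than the logarithm. -/
theorem eventually_mul_log_le (ε : ℝ) (hε : 0 < ε) (κ : ℝ) : ∀ᶠ n : ℕ in atTop,
    κ * Real.log n ≤ Real.log n * Real.log (Real.log n) ^ 2 *
      Real.log (Real.log (Real.log n)) ^ (ε - 2) := by
  have h1 : Tendsto (fun n : ℕ => Real.log n) atTop atTop :=
    Real.tendsto_log_atTop.comp tendsto_natCast_atTop_atTop
  have h2 := Real.tendsto_log_atTop.comp h1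
  have h3 := Real.tendsto_log_atTop.comp h2
  filter_upwards [h1.eventually_gt_atTop 0, h2.eventually_ge_atTop (4 * κ),
    h2.eventually_gt_atTop 0, h3.eventually_ge_atTop 1] with n e1 e2 e3 e4
  simp only [Function.comp] at e2 e3 e4
  generalize Real.log n = L at *
  generalize Real.log L = t at *
  rw [mul_comm κ, mul_assoc]
  refine mul_le_mul_of_nonneg_left ?_ e1.le
  have hpos : 0 < Real.log t := by linarith
  have h5 : Real.log t ^ 2 ≤ 4 * t := by
    have hs : 0 < √t := Real.sqrt_pos.2 e3
    have h6 : Real.log t ≤ 2 * √t := by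
      have h7 := Real.log_le_sub_one_of_pos hs
      have h8 : Real.log t = 2 * Real.log √t := by
        rw [Real.log_sqrt e3.le]; ring
      linarith
    calc Real.log t ^ 2 ≤ (2 * √t) ^ 2 := by gcongr
      _ = 4 * t := by rw [mul_pow, Real.sq_sqrt e3.le]; norm_num
  have h6 : (Real.log t ^ 2)⁻¹ ≤ Real.log t ^ (ε - 2) := by
    rw [← Real.rpow_natCast, ← Real.rpow_neg hpos.le]
    exact Real.rpow_le_rpow_of_exponent_le e4 (by push_cast; linarith)
  calc κ ≤ t ^ 2 * (4 * t)⁻¹ := by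
        rw [← div_eq_mul_inv, le_div_iff₀ (by positivity)]
        nlinarith
    _ ≤ t ^ 2 * (Real.log t ^ 2)⁻¹ := by gcongr
    _ ≤ _ := by gcongr

theorem corollary5p3 (ε : ℝ) (hε : 0 < ε) :
    AlmostAllNat (fun n : ℕ => ¬ 4 ∣ n → ¬ n ≡ 7 [MOD 8] →
      IsMicrosquareSum n
        (Real.log n * Real.log (Real.log n) ^ 2 * Real.log (Real.log (Real.log n)) ^ (ε - 2))) := by
  set Y : ℕ → ℝ := fun n =>
    Real.log n * Real.log (Real.log n) ^ 2 * Real.log (Real.log (Real.log n)) ^ (ε - 2) with hY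
  have h := tendsto_density_zero_of_windows
    {n : ℕ | ¬ 4 ∣ n ∧ ¬ n ≡ 7 [MOD 8] ∧ ¬ IsMicrosquareSum n (Y n)} (by
      intro η hη
      filter_upwards [exists_sparse_window Y (eventually_mul_log_le ε hε) (min η 1)
        (by positivity) (min_le_right _ _)] with E hE
      obtain ⟨B, hB, hc⟩ := hE
      refine ⟨B, hB, hc.trans ?_⟩
      have h1 : (B : ℝ) + 2 ≤ E := by exact_mod_cast hB
      have h2 : (0 : ℝ) ≤ B * ((E : ℝ) - B) := mul_nonneg (by positivity) (by linarith)
      gcongr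
      exact min_le_left _ _)
  unfold AlmostAllNat
  refine h.congr fun N => ?_
  congr 3
  ext n
  simp only [Set.mem_inter_iff, Set.mem_ofPred_eq, Set.mem_Icc, hY]
  tauto
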